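/- Let $G$ be a finite group and $k$ a field whose characteristic does not divide $|G|$. Yetter--Drinfeld modules. A Yetter--Drinfeld $kG$-module is a left $kG$-module $V$ with a left $kG$-comodule structure $\delta(v)=\sum v_{(-1)}\otimes v_{(0)}$ such that $\delta(h\cdot v)=\sum h_{(1)}v_{(-1)}S(h_{(3)})\otimes h_{(2)}\cdot v_{(0)}$. Nichols algebra of $V$: a graded braided Hopf algebra $R=\bigoplus_{n\ge 0}R_{(n)}$ in the braided category ${}^{kG}_{kG}\mathcal{YD}$ with $R_{(0)}=k1$, $R_{(1)}\cong V$ as Yetter--Drinfeld modules, $R_{(1)}$ equal to the space of primitive elements of $R$, and $R$ generated by $R_{(1)}$ as an algebra; it is denoted $\mathcal B(V)$. RSR. Let $\mathcal K(G)$ be the set of conjugacy classes of $G$ and $Z_s$ the centralizer of $s\in G$. A ramification system with irreducible representations $\mathrm{RSR}(G,r,\overrightarrow\rho,u)$ consists of cardinal numbers $r_C$ $(C\in\mathcal K(G))$, elements $u(C)\in C$, and, for each $C$, a family $(\rho_C^{(i)})_{i\in I_C(r,u)}$ of irreducible right representations of $Z_{u(C)}$ over $k$ on spaces $X_C^{(i)}$,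 with index sets $J_C(i)$ of cardinality $\dim X_C^{(i)}$ such that the set of pairs $(i,j)$, $i\in I_C(r,u)$, $j\in J_C(i)$, has cardinality $r_C$. The module $(kQ_1^1,\mathrm{ad}(G,r,\overrightarrow\rho,u))$. Let $Q$ be the quiver with vertex set $G$ and with arrows $a_{y,x}^{(i,j)}$ from $x$ to $y$ for $x^{-1}y\in C\in\mathcal K(G)$, $i\in I_C(r,u)$, $j\in J_C(i)$. Choose bases $(x_C^{(i,j)})_{j\in J_C(i)}$ of the $X_C^{(i)}$ and decompositions $G=\bigsqcup_{\theta\in\Theta_C}Z_{u(C)}g_\theta$, with $1$ among the $g_\theta$, and define $\zeta_\theta(h)\in Z_{u(C)}$ by $g_\theta h=\zeta_\theta(h)g_{\theta'}$ with $\theta'\in\Theta_C$. On the space $kQ_1$ spanned by the arrows put $$h\cdot a_{y,x}^{(i,j)}=a_{hy,hx}^{(i,j)},\qquad a_{y,x}^{(i,j)}\cdot h=\sum_{s\in J_C(i)}k_{C,h}^{(i,j,s)}a_{yh,xh}^{(i,s)},\qquad \delta(a_{y,x}^{(i,j)})=y\otimes a_{y,x}^{(i,j)},$$ where $x^{-1}y=g_\theta^{-1}u(C)g_\theta$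 and $x_C^{(i,j)}\cdot\zeta_\theta(h)=\sum_s k_{C,h}^{(i,j,s)}x_C^{(i,s)}$. The subspace $kQ_1^1$ spanned by the arrows starting at $1$, with the action $g\rhd a=g\cdot a\cdot g^{-1}$ and the coaction $\delta$, is a Yetter--Drinfeld $kG$-module, denoted $(kQ_1^1,\mathrm{ad}(G,r,\overrightarrow\rho,u))$. Then: (i) For every Yetter--Drinfeld $kG$-module $N$ there is an $\mathrm{RSR}(G,r,\overrightarrow\rho,u)$ such that, for all choices of bases and coset representatives, $N\cong(kQ_1^1,\mathrm{ad}(G,r,\overrightarrow\rho,u))$ as Yetter--Drinfeld $kG$-modules. (ii) For every Yetter--Drinfeld $kG$-module $N$ and every Nichols algebra $\mathcal B(N)$ of $N$ there is an $\mathrm{RSR}(G,r,\overrightarrow\rho,u)$ such that, for all choices of bases and coset representatives, $(kQ_1^1,\mathrm{ad}(G,r,\overrightarrow\rho,u))$ has a Nichols algebra isomorphic to $\mathcal B(N)$, and every Nichols algebra of it is isomorphic to $\mathcal B(N)$, as graded braided Hopf algebras in ${}^{kG}_{kG}\mathcal{YD}$. -/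

import Mathlib

open scoped TensorProduct

universe u₁ u₂ v w w'

noncomputable section

/-! ### Yetter–Drinfeld modules over a Hopf algebra -/

section YetterDrinfeld

variable (k : Type*) [Field k] (H : Type*) [Ring H] [HopfAlgebra k H]

/-- The linear map `H ⊗ (H ⊗ H) → End (H ⊗ V)` with
`a ⊗ (b ⊗ c) ↦ (x ⊗ v ↦ a x S(c) ⊗ b · v)`. -/
def ydTwist {V : Type*} [AddCommGroup V] [Module k V] (act : H →ₐ[k] Module.End k V) :
    H ⊗[k] (H ⊗[k] H) →ₗ[k] Module.End k (H ⊗[k] V) :=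
  LinearMap.mul' k (Module.End k (H ⊗[k] V)) ∘ₗ
    TensorProduct.map (LinearMap.rTensorHom V ∘ₗ LinearMap.mul k H)
      (LinearMap.mul' k (Module.End k (H ⊗[k] V)) ∘ₗ
        TensorProduct.map (LinearMap.lTensorHom H ∘ₗ act.toLinearMap)
          (LinearMap.rTensorHom V ∘ₗ (LinearMap.mul k H).flip ∘ₗ HopfAlgebra.antipode k))

theorem ydTwist_tmul {V : Type*} [AddCommGroup V] [Module k V] (act : H →ₐ[k] Module.End k V)
    (a b c x : H) (v : V) :
    ydTwist k H act (a ⊗ₜ (b ⊗ₜ c)) (x ⊗ₜ v) =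
      (a * (x * HopfAlgebra.antipode k c)) ⊗ₜ act b v := by
  simp [ydTwist]

/-- A (left-left) Yetter–Drinfeld `H`-module structure on the `k`-vector space `V`: a left
`H`-action and a left `H`-coaction `δ(v) = v₍₋₁₎ ⊗ v₍₀₎` with
`δ(h · v) = h₍₁₎ v₍₋₁₎ S(h₍₃₎) ⊗ h₍₂₎ · v₍₀₎`. -/
structure YetterDrinfeld (V : Type*) [AddCommGroup V] [Module k V] where
  act : H →ₐ[k] Module.End k V
  coact : V →ₗ[k] H ⊗[k] V
  coact_counit : ∀ v, TensorProduct.lid k V (Coalgebra.counit.rTensor V (coact v)) = v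
  coact_coassoc : ∀ v, TensorProduct.assoc k H H V (Coalgebra.comul.rTensor V (coact v)) =
    coact.lTensor H (coact v)
  compat : ∀ h v, coact (act h v) =
    ydTwist k H act (Coalgebra.comul.lTensor H (Coalgebra.comul (R := k) h)) (coact v)

end YetterDrinfeld

namespace YetterDrinfeld

variable {k : Type*} [Field k] {H : Type*} [Ring H] [HopfAlgebra k H]
variable {V : Type*} [AddCommGroup V] [Module k V] {W : Type*} [AddCommGroup W] [Module k W]

/-- `f` is a morphism of Yetter–Drinfeld modules: left `H`-linear and left `H`-colinear. -/
def IsHom (X : YetterDrinfeld k H V) (Y : YetterDrinfeld k H W) (f : V →ₗ[k] W) : Prop :=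
  (∀ h v, f (X.act h v) = Y.act h (f v)) ∧ ∀ v, Y.coact (f v) = f.lTensor H (X.coact v)

/-- `X ≅ Y` as Yetter–Drinfeld modules. -/
def Isomorphic (X : YetterDrinfeld k H V) (Y : YetterDrinfeld k H W) : Prop :=
  ∃ e : V ≃ₗ[k] W, X.IsHom Y e

/-- The braiding `V ⊗ W → W ⊗ V`, `v ⊗ w ↦ v₍₋₁₎ · w ⊗ v₍₀₎`. -/
def braiding (X : YetterDrinfeld k H V) (Y : YetterDrinfeld k H W) : V ⊗[k] W →ₗ[k] W ⊗[k] V :=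
  (TensorProduct.lift Y.act.toLinearMap).rTensor V ∘ₗ
    (TensorProduct.assoc k H W V).symm.toLinearMap ∘ₗ
    (TensorProduct.comm k V W).toLinearMap.lTensor H ∘ₗ
    (TensorProduct.assoc k H V W).toLinearMap ∘ₗ X.coact.rTensor W

/-- The diagonal action on `V ⊗ W`: `h · (v ⊗ w) = h₍₁₎ · v ⊗ h₍₂₎ · w`. -/
def tensorAct (X : YetterDrinfeld k H V) (Y : YetterDrinfeld k H W) :
    H →ₗ[k] Module.End k (V ⊗[k] W) :=
  TensorProduct.homTensorHomMap (RingHom.id k) V W V W ∘ₗ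
    TensorProduct.map X.act.toLinearMap Y.act.toLinearMap ∘ₗ Coalgebra.comul

/-- The codiagonal coaction on `V ⊗ W`: `v ⊗ w ↦ v₍₋₁₎ w₍₋₁₎ ⊗ (v₍₀₎ ⊗ w₍₀₎)`. -/
def tensorCoact (X : YetterDrinfeld k H V) (Y : YetterDrinfeld k H W) :
    V ⊗[k] W →ₗ[k] H ⊗[k] (V ⊗[k] W) :=
  (LinearMap.mul' k H).rTensor (V ⊗[k] W) ∘ₗ
    (TensorProduct.tensorTensorTensorComm k H V H W).toLinearMap ∘ₗ
    TensorProduct.map X.coact Y.coact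

/-- `id ⊗ c ⊗ id` on `(V ⊗ V) ⊗ (V ⊗ V)`, where `c` is the braiding of `V` with itself. -/
def midBraiding (X : YetterDrinfeld k H V) :
    (V ⊗[k] V) ⊗[k] (V ⊗[k] V) →ₗ[k] (V ⊗[k] V) ⊗[k] (V ⊗[k] V) :=
  (TensorProduct.assoc k V V (V ⊗[k] V)).symm.toLinearMap ∘ₗ
    ((TensorProduct.assoc k V V V).toLinearMap ∘ₗ (X.braiding X).rTensor V ∘ₗ
      (TensorProduct.assoc k V V V).symm.toLinearMap).lTensor V ∘ₗ
    (TensorProduct.assoc k V V (V ⊗[k] V)).toLinearMap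

end YetterDrinfeld

/-! ### Graded braided Hopf algebras and Nichols algebras -/

/-- A graded braided Hopf algebra `R = ⨁ₙ R(n)` in the category of Yetter–Drinfeld `H`-modules. -/
structure GradedBraidedHopfAlgebra (k : Type u₁) [Field k] (H : Type u₂) [Ring H]
    [HopfAlgebra k H] where
  carrier : Type w
  [ring : Ring carrier]
  [algebra : Algebra k carrier]
  [coalgebra : Coalgebra k carrier]
  yd : YetterDrinfeld k H carrier
  /- unit, multiplication, counit and comultiplication are Yetter–Drinfeld morphisms -/
  act_one : ∀ h, yd.act h 1 = Coalgebra.counit (R := k) h • (1 : carrier)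
  coact_one : yd.coact 1 = 1 ⊗ₜ 1
  act_mul : ∀ h (t : carrier ⊗[k] carrier),
    yd.act h (LinearMap.mul' k carrier t) = LinearMap.mul' k carrier (yd.tensorAct yd h t)
  coact_mul : ∀ t : carrier ⊗[k] carrier, yd.coact (LinearMap.mul' k carrier t) =
    (LinearMap.mul' k carrier).lTensor H (yd.tensorCoact yd t)
  act_counit : ∀ h (a : carrier), Coalgebra.counit (R := k) (yd.act h a) =
    Coalgebra.counit (R := k) h * Coalgebra.counit (R := k) a
  coact_counit : ∀ a : carrier,
    (Coalgebra.counit (R := k) (A := carrier)).lTensor H (yd.coact a) =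
      1 ⊗ₜ Coalgebra.counit (R := k) a
  act_comul : ∀ h (a : carrier), Coalgebra.comul (R := k) (yd.act h a) =
    yd.tensorAct yd h (Coalgebra.comul (R := k) a)
  coact_comul : ∀ a : carrier, yd.tensorCoact yd (Coalgebra.comul (R := k) a) =
    (Coalgebra.comul (R := k) (A := carrier)).lTensor H (yd.coact a)
  /- counit and comultiplication are algebra maps, `R ⊗ R` carrying the braided product -/
  counit_one : Coalgebra.counit (R := k) (1 : carrier) = 1
  counit_mul : ∀ a b : carrier, Coalgebra.counit (R := k) (a * b) =
    Coalgebra.counit (R := k) a * Coalgebra.counit (R := k) b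
  comul_one : Coalgebra.comul (R := k) (1 : carrier) = 1 ⊗ₜ 1
  comul_mul : ∀ a b : carrier, Coalgebra.comul (R := k) (a * b) =
    TensorProduct.map (LinearMap.mul' k carrier) (LinearMap.mul' k carrier)
      (yd.midBraiding (Coalgebra.comul (R := k) a ⊗ₜ[k] Coalgebra.comul (R := k) b))
  /- the antipode, a Yetter–Drinfeld morphism -/
  antipode : carrier →ₗ[k] carrier
  antipode_isHom : yd.IsHom yd antipode
  mul_antipode_left : ∀ a : carrier,
    LinearMap.mul' k carrier (antipode.rTensor carrier (Coalgebra.comul (R := k) a)) =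
      algebraMap k carrier (Coalgebra.counit (R := k) a)
  mul_antipode_right : ∀ a : carrier,
    LinearMap.mul' k carrier (antipode.lTensor carrier (Coalgebra.comul (R := k) a)) =
      algebraMap k carrier (Coalgebra.counit (R := k) a)
  /- the grading, by Yetter–Drinfeld submodules, respected by all the structure maps -/
  comp : ℕ → Submodule k carrier
  isInternal : DirectSum.IsInternal comp
  one_mem : (1 : carrier) ∈ comp 0
  mul_mem : ∀ {m n : ℕ} {a b : carrier}, a ∈ comp m → b ∈ comp n → a * b ∈ comp (m + n)
  act_mem : ∀ (h : H) {n : ℕ} {a : carrier}, a ∈ comp n → yd.act h a ∈ comp n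
  coact_mem : ∀ {n : ℕ} {a : carrier}, a ∈ comp n →
    yd.coact a ∈ LinearMap.range ((comp n).subtype.lTensor H)
  counit_of_mem : ∀ {n : ℕ} {a : carrier}, n ≠ 0 → a ∈ comp n → Coalgebra.counit (R := k) a = 0
  comul_mem : ∀ {n : ℕ} {a : carrier}, a ∈ comp n → Coalgebra.comul (R := k) a ∈
    ⨆ p ∈ Finset.HasAntidiagonal.antidiagonal n,
      LinearMap.range (TensorProduct.map (comp p.1).subtype (comp p.2).subtype)
  antipode_mem : ∀ {n : ℕ} {a : carrier}, a ∈ comp n → antipode a ∈ comp n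

namespace GradedBraidedHopfAlgebra

attribute [instance] ring algebra coalgebra

variable {k : Type*} [Field k] {H : Type*} [Ring H] [HopfAlgebra k H]

/-- `R ≅ R'` as graded braided Hopf algebras in the category of Yetter–Drinfeld `H`-modules: a
degree-preserving bijection that is an algebra, coalgebra, `H`-module and `H`-comodule map
(such a map commutes with the antipodes, by uniqueness of convolution inverses). -/
def Isomorphic (R : GradedBraidedHopfAlgebra.{_, _, w} k H)
    (R' : GradedBraidedHopfAlgebra.{_, _, w'} k H) : Prop :=
  ∃ e : R.carrier ≃ₐ[k] R'.carrier,
    R.yd.IsHom R'.yd e.toLinearMap ∧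
    (∀ a, Coalgebra.counit (R := k) (e a) = Coalgebra.counit (R := k) a) ∧
    (∀ a, Coalgebra.comul (R := k) (e a) =
      TensorProduct.map e.toLinearMap e.toLinearMap (Coalgebra.comul (R := k) a)) ∧
    ∀ n, (R.comp n).map e.toLinearMap = R'.comp n

/-- `R` is a Nichols algebra of the Yetter–Drinfeld module `V`: `R(0) = k1`, `R(1) ≅ V` as
Yetter–Drinfeld modules, `R(1)` is the space of primitive elements, and `R(1)` generates `R`
as an algebra. -/
structure IsNicholsAlgebra (R : GradedBraidedHopfAlgebra.{_, _, w} k H)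
    {V : Type*} [AddCommGroup V] [Module k V] (Y : YetterDrinfeld k H V) : Prop where
  comp_zero : R.comp 0 = Submodule.span k {1}
  comp_one : ∃ f : V →ₗ[k] R.carrier,
    Y.IsHom R.yd f ∧ Function.Injective f ∧ LinearMap.range f = R.comp 1
  primitive : ∀ a : R.carrier,
    Coalgebra.comul (R := k) a = a ⊗ₜ[k] 1 + 1 ⊗ₜ[k] a ↔ a ∈ R.comp 1
  generated : Algebra.adjoin k (R.comp 1 : Set R.carrier) = ⊤

end GradedBraidedHopfAlgebra

/-! ### Ramification systems with irreducible representations -/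

/-- A ramification system with irreducible representations `(G, r, ρ, u)`. Representations of the
centralizers `Z_{u(C)}` act from the right, i.e. they are representations of the opposite group.
`I C` is `I_C(r, u)` and `J C i` is `J_C(i)`; the set `I_C(r)` of pairs `(i, j)` has cardinality
`r_C`, so that `I C` is empty when `r_C = 0`. -/
structure RSR (k : Type u₁) [Field k] (G : Type u₂) [Group G] where
  r : ConjClasses G → Cardinal.{v}
  u : ConjClasses G → G
  u_mem : ∀ C, u C ∈ C.carrier
  I : ConjClasses G → Type v
  J : ∀ C, I C → Type v
  X : ∀ C, I C → Type v
  [addCommGroup : ∀ C i, AddCommGroup (X C i)]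
  [module : ∀ C i, Module k (X C i)]
  ρ : ∀ C i, Representation k (Subgroup.centralizer {u C})ᵐᵒᵖ (X C i)
  irreducible : ∀ C i, (ρ C i).IsIrreducible
  card_J : ∀ C i, Cardinal.mk (J C i) = Module.rank k (X C i)
  card_I : ∀ C, Cardinal.mk (Σ i : I C, J C i) = r C

namespace RSR

attribute [instance] RSR.addCommGroup RSR.module

variable {k : Type u₁} [Field k] {G : Type u₂} [Group G]

/-- The choices made in order to write down the arrow bimodule of an RSR: bases
`x_C^{(i,j)}`, `j ∈ J_C(i)`, of the representation spaces, and coset decompositions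
`G = ⋃_θ Z_{u(C)} g_θ` in which `1` represents the coset `Z_{u(C)}`. The index set `Θ_C` is the set
`Θ C` of representatives itself. -/
structure Choices (S : RSR.{u₁, u₂, v} k G) where
  basis : ∀ C i, Module.Basis (S.J C i) k (S.X C i)
  Θ : ConjClasses G → Set G
  isComplement : ∀ C, Subgroup.IsComplement (Subgroup.centralizer {S.u C} : Set G) (Θ C)
  one_mem : ∀ C, 1 ∈ Θ C

/-- Such choices always exist. -/
theorem choices_nonempty (S : RSR.{u₁, u₂, v} k G) : Nonempty S.Choices := by
  have h1 : ∀ C i, Nonempty (Module.Basis (S.J C i) k (S.X C i)) := fun C i => by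
    have b := Module.Free.chooseBasis k (S.X C i)
    have h := b.mk_eq_rank''.trans (S.card_J C i).symm
    exact ⟨b.reindex (Cardinal.eq.1 h).some⟩
  choose T hT using fun C => (Subgroup.centralizer {S.u C}).exists_isComplement_right 1
  exact ⟨⟨fun C i => (h1 C i).some, T, fun C => (hT C).1, fun C => (hT C).2⟩⟩

/-- The arrows `a_{y,x}^{(i,j)}` of the Hopf quiver `(Q, G, r)`, with start vertex `x = src` and end
vertex `y = tgt`, where `x⁻¹y ∈ C`, `i ∈ I_C(r, u)`, `j ∈ J_C(i)`. -/
@[ext] structure Arrow (S : RSR.{u₁, u₂, v} k G) where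
  C : ConjClasses G
  i : S.I C
  j : S.J C i
  src : G
  tgt : G
  mem : src⁻¹ * tgt ∈ C.carrier

/-- There are `r_C` arrows from `x` to `y` if `x⁻¹y ∈ C`. -/
theorem card_arrow (S : RSR.{u₁, u₂, v} k G) (x y : G) (C : ConjClasses G)
    (h : x⁻¹ * y ∈ C.carrier) :
    Cardinal.mk {a : S.Arrow // a.src = x ∧ a.tgt = y} = Cardinal.lift.{u₂} (S.r C) := by
  rw [← S.card_I, ← Cardinal.mk_uLift]
  refine Cardinal.mk_congr (Equiv.trans (Equiv.ofBijective (fun p : Σ i : S.I C, S.J C i =>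
    (⟨⟨C, p.1, p.2, x, y, h⟩, rfl, rfl⟩ : {a : S.Arrow // a.src = x ∧ a.tgt = y}))
    ⟨?_, ?_⟩).symm Equiv.ulift.symm)
  · rintro ⟨i, j⟩ ⟨i', j'⟩ hij
    simpa using hij
  · rintro ⟨⟨C', i, j, x', y', h'⟩, rfl, rfl⟩
    obtain rfl : C = C' := by
      rw [ConjClasses.mem_carrier_iff_mk_eq] at h h'
      exact h.symm.trans h'
    exact ⟨⟨i, j⟩, rfl⟩

section Arrows

variable {S : RSR.{u₁, u₂, v} k G} (c : S.Choices)

/-- For `y ∈ C` there is `θ ∈ Θ_C` with `y = g_θ⁻¹ u(C) g_θ`. -/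
theorem Choices.exists_theta {C : ConjClasses G} {y : G} (hy : y ∈ C.carrier) :
    ∃ θ : c.Θ C, y = (θ : G)⁻¹ * S.u C * θ := by
  have h1 := S.u_mem C
  rw [ConjClasses.mem_carrier_iff_mk_eq] at hy h1
  obtain ⟨g, hg⟩ := isConj_iff.1 (ConjClasses.mk_eq_mk_iff_isConj.1 (hy.trans h1.symm))
  refine ⟨((c.isComplement C).equiv g).snd, ?_⟩
  have h2 := (c.isComplement C).equiv_fst_mul_equiv_snd g
  have h3 := ((c.isComplement C).equiv g).fst.2
  rw [SetLike.mem_coe, Subgroup.mem_centralizer_singleton_iff] at h3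
  generalize (((c.isComplement C).equiv g).fst : G) = z at h2 h3
  generalize (((c.isComplement C).equiv g).snd : G) = t at h2
  subst h2
  have h4 : y = (z * t)⁻¹ * S.u C * (z * t) := by rw [← hg]; group
  rw [h4, show (z * t)⁻¹ * S.u C * (z * t) = t⁻¹ * (z⁻¹ * (S.u C * z)) * t by group, ← h3]
  group

/-- The index `θ` with `y = g_θ⁻¹ u(C) g_θ`, for `y ∈ C`. -/
def Choices.theta {C : ConjClasses G} {y : G} (hy : y ∈ C.carrier) : c.Θ C :=
  (c.exists_theta hy).choose

/-- `ζ_θ(h) ∈ Z_{u(C)}`, determined by `g_θ h = ζ_θ(h) g_θ'` with `θ' ∈ Θ_C`. -/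
def Choices.zeta {C : ConjClasses G} (θ : c.Θ C) (h : G) : Subgroup.centralizer {S.u C} :=
  ((c.isComplement C).equiv (θ * h)).fst

/-- The arrow space `kQ₁`. -/
abbrev ArrowSpace (S : RSR.{u₁, u₂, v} k G) : Type _ := S.Arrow →₀ k

/-- The linear map `X_C^{(i)} → kQ₁` with `x_C^{(i,j)} ↦ a_{y,x}^{(i,j)}`. -/
def Choices.arrowVec {C : ConjClasses G} (i : S.I C) (x y : G) (h : x⁻¹ * y ∈ C.carrier) :
    S.X C i →ₗ[k] S.ArrowSpace :=
  Finsupp.lmapDomain k k (fun j => (⟨C, i, j, x, y, h⟩ : S.Arrow)) ∘ₗ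
    (c.basis C i).repr.toLinearMap

theorem mem_left {C : ConjClasses G} {x y : G} (h : x⁻¹ * y ∈ C.carrier) (g : G) :
    (g * x)⁻¹ * (g * y) ∈ C.carrier := by
  rwa [show (g * x)⁻¹ * (g * y) = x⁻¹ * y by group]

theorem mem_right {C : ConjClasses G} {x y : G} (h : x⁻¹ * y ∈ C.carrier) (g : G) :
    (x * g)⁻¹ * (y * g) ∈ C.carrier := by
  rw [ConjClasses.mem_carrier_iff_mk_eq] at h ⊢
  rw [← h, ConjClasses.mk_eq_mk_iff_isConj, isConj_iff]
  exact ⟨g, by group⟩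

/-- The left action `g · a_{y,x}^{(i,j)} = a_{gy,gx}^{(i,j)}` on `kQ₁`. -/
def leftMul (S : RSR.{u₁, u₂, v} k G) (g : G) : S.ArrowSpace →ₗ[k] S.ArrowSpace :=
  Finsupp.lmapDomain k k (fun a => ⟨a.C, a.i, a.j, g * a.src, g * a.tgt, mem_left a.mem g⟩)

/-- The right action `a_{y,x}^{(i,j)} · g = ∑ₛ k_{C,g}^{(i,j,s)} a_{yg,xg}^{(i,s)}` on `kQ₁`, where
`x_C^{(i,j)} · ζ_θ(g) = ∑ₛ k_{C,g}^{(i,j,s)} x_C^{(i,s)}` and `x⁻¹y = g_θ⁻¹ u(C) g_θ`. -/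
def Choices.rightMul (g : G) : S.ArrowSpace →ₗ[k] S.ArrowSpace :=
  Finsupp.linearCombination k fun a =>
    c.arrowVec a.i (a.src * g) (a.tgt * g) (mem_right a.mem g)
      (S.ρ a.C a.i (MulOpposite.op (c.zeta (c.theta a.mem) g)) (c.basis a.C a.i a.j))

/-- The adjoint action `g ▷ x = g · x · g⁻¹` on `kQ₁`. -/
def Choices.adjoint (g : G) : S.ArrowSpace →ₗ[k] S.ArrowSpace :=
  c.rightMul g⁻¹ ∘ₗ S.leftMul g

/-- The set `Q₁¹` of arrows with start vertex `1`. -/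
def ArrowsFromOne (S : RSR.{u₁, u₂, v} k G) : Set S.Arrow := {a | a.src = 1}

/-- The space `kQ₁¹`. -/
abbrev ArrowSpaceFromOne (S : RSR.{u₁, u₂, v} k G) : Type _ := S.ArrowsFromOne →₀ k

/-- The inclusion `kQ₁¹ → kQ₁`. -/
def incl (S : RSR.{u₁, u₂, v} k G) : S.ArrowSpaceFromOne →ₗ[k] S.ArrowSpace :=
  Finsupp.lmapDomain k k Subtype.val

/-- The restriction of the adjoint action to `kQ₁¹`; see `incl_adjointFromOne`. -/
def Choices.adjointFromOne (g : G) : S.ArrowSpaceFromOne →ₗ[k] S.ArrowSpaceFromOne :=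
  Finsupp.lsubtypeDomain S.ArrowsFromOne ∘ₗ c.adjoint g ∘ₗ S.incl

theorem Choices.theta_spec {C : ConjClasses G} {y : G} (hy : y ∈ C.carrier) :
    y = (c.theta hy : G)⁻¹ * S.u C * c.theta hy :=
  (c.exists_theta hy).choose_spec

theorem Choices.zeta_mul {C : ConjClasses G} (θ : c.Θ C) (h : G) :
    (c.zeta θ h : G) * ((c.isComplement C).equiv (θ * h)).snd = θ * h :=
  (c.isComplement C).equiv_fst_mul_equiv_snd _

theorem Choices.theta_unique {C : ConjClasses G} {θ θ' : c.Θ C}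
    (h : (θ : G)⁻¹ * S.u C * θ = (θ' : G)⁻¹ * S.u C * θ') : θ = θ' := by
  have hz : (θ : G) * (θ' : G)⁻¹ ∈ Subgroup.centralizer {S.u C} := by
    rw [Subgroup.mem_centralizer_singleton_iff]
    calc (θ : G) * (θ' : G)⁻¹ * S.u C
        = θ * ((θ' : G)⁻¹ * S.u C * θ') * (θ' : G)⁻¹ := by group
      _ = S.u C * (θ * (θ' : G)⁻¹) := by rw [← h]; group
  have := (c.isComplement C).1 (a₁ := (⟨_, hz⟩, θ')) (a₂ := (⟨1, Subgroup.one_mem _⟩, θ)) (by simp)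
  exact (congrArg Prod.snd this).symm

theorem Choices.theta_right {C : ConjClasses G} {x y : G} (h : x⁻¹ * y ∈ C.carrier) (g : G) :
    c.theta (mem_right h g) = ((c.isComplement C).equiv (c.theta h * g)).snd := by
  apply c.theta_unique
  rw [← c.theta_spec]
  have h1 := c.theta_spec h
  have h2 := c.zeta_mul (c.theta h) g
  have h3 := (c.zeta (c.theta h) g).2
  rw [Subgroup.mem_centralizer_singleton_iff] at h3
  generalize (c.zeta (c.theta h) g : G) = z at h2 h3
  generalize (((c.isComplement C).equiv (c.theta h * g)).snd : G) = t at h2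
  calc (x * g)⁻¹ * (y * g) = g⁻¹ * (x⁻¹ * y) * g := by group
    _ = g⁻¹ * ((c.theta h : G)⁻¹ * S.u C * c.theta h) * g := congrArg (g⁻¹ * · * g) h1
    _ = (c.theta h * g)⁻¹ * S.u C * (c.theta h * g) := by group
    _ = t⁻¹ * (z⁻¹ * (S.u C * z)) * t := by rw [← h2]; group
    _ = t⁻¹ * S.u C * t := by rw [← h3]; group

theorem Choices.zeta_one {C : ConjClasses G} (θ : c.Θ C) : c.zeta θ 1 = 1 := by
  apply Subtype.ext
  unfold Choices.zeta
  rw [mul_one]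
  exact congrArg Subtype.val <| (c.isComplement C).equiv_fst_eq_one_of_mem_of_one_mem (Subgroup.one_mem _) θ.2

theorem Choices.zeta_mul_mul {C : ConjClasses G} {x y : G} (h : x⁻¹ * y ∈ C.carrier) (g g' : G) :
    c.zeta (c.theta h) (g * g') =
      c.zeta (c.theta h) g * c.zeta (c.theta (mem_right h g)) g' := by
  have h1 := c.zeta_mul (c.theta h) g
  rw [← c.theta_right] at h1
  have h2 := c.zeta_mul (c.theta (mem_right h g)) g'
  have h3 := c.zeta_mul (c.theta h) (g * g')
  have := (c.isComplement C).1
    (a₁ := (c.zeta (c.theta h) (g * g'), ((c.isComplement C).equiv (c.theta h * (g * g'))).snd))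
    (a₂ := (c.zeta (c.theta h) g * c.zeta (c.theta (mem_right h g)) g',
      ((c.isComplement C).equiv (c.theta (mem_right h g) * g')).snd))
    (by
      change (c.zeta (c.theta h) (g * g') : G) * _ =
        ((c.zeta (c.theta h) g : G) * (c.zeta (c.theta (mem_right h g)) g' : G)) * _
      rw [h3, mul_assoc _ _ (Subtype.val _), h2, ← mul_assoc, ← mul_assoc, h1])
  exact congrArg Prod.fst this

theorem Choices.arrowVec_basis {C : ConjClasses G} (i : S.I C) (j : S.J C i) (x y : G)
    (h : x⁻¹ * y ∈ C.carrier) :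
    c.arrowVec i x y h (c.basis C i j) = Finsupp.single ⟨C, i, j, x, y, h⟩ 1 := by
  simp [Choices.arrowVec]

theorem Choices.leftMul_arrowVec {C : ConjClasses G} (i : S.I C) (x y : G)
    (h : x⁻¹ * y ∈ C.carrier) (g : G) (w : S.X C i) :
    S.leftMul g (c.arrowVec i x y h w) = c.arrowVec i (g * x) (g * y) (mem_left h g) w := by
  suffices S.leftMul g ∘ₗ c.arrowVec i x y h = c.arrowVec i (g * x) (g * y) (mem_left h g) from
    LinearMap.congr_fun this w
  refine (c.basis C i).ext fun j => ?_
  simp [arrowVec_basis, leftMul]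

theorem Choices.rightMul_arrowVec {C : ConjClasses G} (i : S.I C) (x y : G)
    (h : x⁻¹ * y ∈ C.carrier) (g : G) (w : S.X C i) :
    c.rightMul g (c.arrowVec i x y h w) = c.arrowVec i (x * g) (y * g) (mem_right h g)
      (S.ρ C i (MulOpposite.op (c.zeta (c.theta h) g)) w) := by
  suffices c.rightMul g ∘ₗ c.arrowVec i x y h = c.arrowVec i (x * g) (y * g) (mem_right h g) ∘ₗ
      S.ρ C i (MulOpposite.op (c.zeta (c.theta h) g)) from LinearMap.congr_fun this w
  refine (c.basis C i).ext fun j => ?_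
  simp [arrowVec_basis, rightMul]

theorem Choices.hom_ext {W : Type*} [AddCommGroup W] [Module k W]
    {f f' : S.ArrowSpace →ₗ[k] W}
    (hf : ∀ (C : ConjClasses G) (i : S.I C) (x y : G) (h : x⁻¹ * y ∈ C.carrier) (w : S.X C i),
      f (c.arrowVec i x y h w) = f' (c.arrowVec i x y h w)) : f = f' := by
  refine Finsupp.lhom_ext' fun a => LinearMap.ext_ring ?_
  simpa [arrowVec_basis] using hf a.C a.i a.src a.tgt a.mem (c.basis a.C a.i a.j)

theorem Choices.arrowVec_congr {C : ConjClasses G} (i : S.I C) {x x' y y' : G} (hx : x = x')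
    (hy : y = y') (h : x⁻¹ * y ∈ C.carrier) (h' : x'⁻¹ * y' ∈ C.carrier) (w : S.X C i) :
    c.arrowVec i x y h w = c.arrowVec i x' y' h' w := by
  subst hx hy; rfl

theorem leftMul_one : S.leftMul (1 : G) = LinearMap.id := by
  refine Finsupp.lhom_ext' fun a => LinearMap.ext_ring ?_
  simp [leftMul]

theorem leftMul_mul (g g' : G) : S.leftMul (g * g') = S.leftMul g ∘ₗ S.leftMul g' := by
  refine Finsupp.lhom_ext' fun a => LinearMap.ext_ring ?_
  simp [leftMul, mul_assoc]

theorem Choices.rightMul_one : c.rightMul 1 = LinearMap.id := by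
  refine c.hom_ext fun C i x y h w => ?_
  rw [rightMul_arrowVec, zeta_one, MulOpposite.op_one, map_one]
  exact c.arrowVec_congr i (mul_one x) (mul_one y) _ _ w

theorem Choices.rightMul_mul (g g' : G) :
    c.rightMul (g * g') = c.rightMul g' ∘ₗ c.rightMul g := by
  refine c.hom_ext fun C i x y h w => ?_
  rw [LinearMap.comp_apply, rightMul_arrowVec, rightMul_arrowVec, rightMul_arrowVec, zeta_mul_mul,
    MulOpposite.op_mul, map_mul]
  exact c.arrowVec_congr i (mul_assoc ..).symm (mul_assoc ..).symm _ _ _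

theorem Choices.theta_left {C : ConjClasses G} {x y : G} (h : x⁻¹ * y ∈ C.carrier) (g : G) :
    c.theta (mem_left h g) = c.theta h := by
  apply c.theta_unique
  rw [← c.theta_spec, ← c.theta_spec]
  group

theorem Choices.leftMul_rightMul (g g' : G) :
    S.leftMul g ∘ₗ c.rightMul g' = c.rightMul g' ∘ₗ S.leftMul g := by
  refine c.hom_ext fun C i x y h w => ?_
  simp only [LinearMap.comp_apply, rightMul_arrowVec, leftMul_arrowVec, c.theta_left h g]
  exact c.arrowVec_congr i (mul_assoc ..).symm (mul_assoc ..).symm _ _ _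

theorem Choices.adjoint_one : c.adjoint 1 = LinearMap.id := by
  rw [adjoint, inv_one, rightMul_one, leftMul_one, LinearMap.id_comp]

theorem Choices.adjoint_mul (g g' : G) : c.adjoint (g * g') = c.adjoint g ∘ₗ c.adjoint g' := by
  refine LinearMap.ext fun x => ?_
  simp only [adjoint, mul_inv_rev, rightMul_mul, leftMul_mul, LinearMap.comp_apply]
  rw [← LinearMap.comp_apply (c.rightMul _) (S.leftMul g), ← leftMul_rightMul]
  rfl

theorem Choices.adjoint_arrowVec {C : ConjClasses G} (i : S.I C) (x y : G)
    (h : x⁻¹ * y ∈ C.carrier) (g : G) (w : S.X C i) :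
    c.adjoint g (c.arrowVec i x y h w) = c.arrowVec i (g * x * g⁻¹) (g * y * g⁻¹)
      (mem_right (mem_left h g) g⁻¹)
      (S.ρ C i (MulOpposite.op (c.zeta (c.theta h) g⁻¹)) w) := by
  rw [adjoint, LinearMap.comp_apply, leftMul_arrowVec, rightMul_arrowVec, c.theta_left h g]

/-- The linear map `X_C^{(i)} → kQ₁¹` with `x_C^{(i,j)} ↦ a_{y,1}^{(i,j)}`. -/
def Choices.arrowVecOne {C : ConjClasses G} (i : S.I C) (y : G) (h : 1⁻¹ * y ∈ C.carrier) :
    S.X C i →ₗ[k] S.ArrowSpaceFromOne :=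
  Finsupp.lmapDomain k k
    (fun j => (⟨⟨C, i, j, 1, y, h⟩, rfl⟩ : S.ArrowsFromOne)) ∘ₗ (c.basis C i).repr.toLinearMap

theorem Choices.arrowVecOne_basis {C : ConjClasses G} (i : S.I C) (j : S.J C i) (y : G)
    (h : 1⁻¹ * y ∈ C.carrier) :
    c.arrowVecOne i y h (c.basis C i j) = Finsupp.single ⟨⟨C, i, j, 1, y, h⟩, rfl⟩ 1 := by
  simp [Choices.arrowVecOne]

theorem Choices.incl_arrowVecOne {C : ConjClasses G} (i : S.I C) (y : G)
    (h : 1⁻¹ * y ∈ C.carrier) (w : S.X C i) :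
    S.incl (c.arrowVecOne i y h w) = c.arrowVec i 1 y h w := by
  suffices S.incl ∘ₗ c.arrowVecOne i y h = c.arrowVec i 1 y h from LinearMap.congr_fun this w
  refine (c.basis C i).ext fun j => ?_
  simp [arrowVec_basis, arrowVecOne_basis, incl]

theorem Choices.hom_ext_one {W : Type*} [AddCommGroup W] [Module k W]
    {f f' : S.ArrowSpaceFromOne →ₗ[k] W}
    (hf : ∀ (C : ConjClasses G) (i : S.I C) (y : G) (h : 1⁻¹ * y ∈ C.carrier) (w : S.X C i),
      f (c.arrowVecOne i y h w) = f' (c.arrowVecOne i y h w)) : f = f' := by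
  refine Finsupp.lhom_ext' fun a => LinearMap.ext_ring ?_
  obtain ⟨⟨C, i, j, x, y, h⟩, hx⟩ := a
  obtain rfl : x = 1 := hx
  simpa [arrowVecOne_basis] using hf C i y h (c.basis C i j)

theorem subtypeDomain_incl (x : S.ArrowSpaceFromOne) :
    Finsupp.lsubtypeDomain (R := k) (M := k) S.ArrowsFromOne (S.incl x) = x := by
  suffices Finsupp.lsubtypeDomain (R := k) (M := k) S.ArrowsFromOne ∘ₗ S.incl = LinearMap.id from
    LinearMap.congr_fun this x
  refine Finsupp.lhom_ext' fun a => LinearMap.ext_ring ?_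
  ext b
  classical
  simp only [incl, LinearMap.comp_apply, Finsupp.lsingle_apply, Finsupp.lmapDomain_apply,
    Finsupp.mapDomain_single, LinearMap.id_apply]
  change Finsupp.single a.1 (1 : k) b.1 = _
  simp [Finsupp.single_apply, Subtype.ext_iff]

theorem mem_adj {C : ConjClasses G} {y : G} (h : 1⁻¹ * y ∈ C.carrier) (g : G) :
    1⁻¹ * (g * y * g⁻¹) ∈ C.carrier := by
  have := mem_right (mem_left h g) g⁻¹
  rwa [show (g * 1 * g⁻¹)⁻¹ * (g * y * g⁻¹) = 1⁻¹ * (g * y * g⁻¹) by group] at this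

theorem Choices.adjoint_incl_arrowVecOne {C : ConjClasses G} (i : S.I C) (y : G)
    (h : 1⁻¹ * y ∈ C.carrier) (g : G) (w : S.X C i) :
    c.adjoint g (S.incl (c.arrowVecOne i y h w)) = S.incl (c.arrowVecOne i (g * y * g⁻¹)
      (mem_adj h g) (S.ρ C i (MulOpposite.op (c.zeta (c.theta h) g⁻¹)) w)) := by
  rw [incl_arrowVecOne, incl_arrowVecOne, adjoint_arrowVec]
  exact c.arrowVec_congr i (by group) rfl _ _ _

theorem Choices.adjointFromOne_arrowVecOne {C : ConjClasses G} (i : S.I C) (y : G)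
    (h : 1⁻¹ * y ∈ C.carrier) (g : G) (w : S.X C i) :
    c.adjointFromOne g (c.arrowVecOne i y h w) = c.arrowVecOne i (g * y * g⁻¹)
      (mem_adj h g) (S.ρ C i (MulOpposite.op (c.zeta (c.theta h) g⁻¹)) w) := by
  rw [adjointFromOne, LinearMap.comp_apply, LinearMap.comp_apply, adjoint_incl_arrowVecOne,
    subtypeDomain_incl]

/-- `kQ₁¹` is stable under the adjoint action. -/
theorem Choices.incl_adjointFromOne (g : G) (x : S.ArrowSpaceFromOne) :
    S.incl (c.adjointFromOne g x) = c.adjoint g (S.incl x) := by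
  suffices S.incl ∘ₗ c.adjointFromOne g = c.adjoint g ∘ₗ S.incl from LinearMap.congr_fun this x
  refine c.hom_ext_one fun C i y h w => ?_
  rw [LinearMap.comp_apply, LinearMap.comp_apply, adjointFromOne_arrowVecOne,
    adjoint_incl_arrowVecOne]

theorem Choices.adjointFromOne_one : c.adjointFromOne 1 = LinearMap.id := by
  refine LinearMap.ext fun x => ?_
  simp [adjointFromOne, adjoint_one, subtypeDomain_incl]

theorem Choices.adjointFromOne_mul (g g' : G) :
    c.adjointFromOne (g * g') = c.adjointFromOne g ∘ₗ c.adjointFromOne g' := by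
  refine LinearMap.ext fun x => ?_
  rw [LinearMap.comp_apply]
  conv_rhs => rw [adjointFromOne, LinearMap.comp_apply, LinearMap.comp_apply, incl_adjointFromOne]
  rw [adjointFromOne, adjoint_mul]
  rfl

/-- The coaction `δ⁻(a_{y,x}) = y ⊗ a_{y,x}` on `kQ₁¹`. -/
def coactFromOne (S : RSR.{u₁, u₂, v} k G) :
    S.ArrowSpaceFromOne →ₗ[k] MonoidAlgebra k G ⊗[k] S.ArrowSpaceFromOne :=
  Finsupp.linearCombination k fun a =>
    MonoidAlgebra.single a.1.tgt (1 : k) ⊗ₜ[k] Finsupp.single a (1 : k)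

theorem Choices.coactFromOne_arrowVecOne {C : ConjClasses G} (i : S.I C) (y : G)
    (h : 1⁻¹ * y ∈ C.carrier) (w : S.X C i) :
    S.coactFromOne (c.arrowVecOne i y h w) =
      MonoidAlgebra.single y (1 : k) ⊗ₜ[k] c.arrowVecOne i y h w := by
  suffices S.coactFromOne ∘ₗ c.arrowVecOne i y h =
      TensorProduct.mk k (MonoidAlgebra k G) S.ArrowSpaceFromOne (MonoidAlgebra.single y (1 : k)) ∘ₗ
        c.arrowVecOne i y h from LinearMap.congr_fun this w
  refine (c.basis C i).ext fun j => ?_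
  simp [arrowVecOne_basis, coactFromOne]

/-- The linear extension of the adjoint action on `kQ₁¹` to the group algebra. -/
def Choices.adjointAlgHom : MonoidAlgebra k G →ₐ[k] Module.End k S.ArrowSpaceFromOne :=
  MonoidAlgebra.lift k _ G
    { toFun := c.adjointFromOne
      map_one' := c.adjointFromOne_one
      map_mul' := c.adjointFromOne_mul }

theorem Choices.adjointAlgHom_single (g : G) :
    c.adjointAlgHom (MonoidAlgebra.single g 1) = c.adjointFromOne g := by
  simp [adjointAlgHom]

/-- The Yetter–Drinfeld `kG`-module `(kQ₁¹, ad(G, r, ρ, u))`. -/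
def Choices.ydFromOne : YetterDrinfeld k (MonoidAlgebra k G) S.ArrowSpaceFromOne where
  act := c.adjointAlgHom
  coact := S.coactFromOne
  coact_counit v := by
    suffices (TensorProduct.lid k S.ArrowSpaceFromOne).toLinearMap ∘ₗ
        Coalgebra.counit.rTensor S.ArrowSpaceFromOne ∘ₗ S.coactFromOne = LinearMap.id from
      LinearMap.congr_fun this v
    refine c.hom_ext_one fun C i y h w => ?_
    simp [coactFromOne_arrowVecOne]
  coact_coassoc v := by
    suffices (TensorProduct.assoc k (MonoidAlgebra k G) (MonoidAlgebra k G)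
        S.ArrowSpaceFromOne).toLinearMap ∘ₗ
        Coalgebra.comul.rTensor S.ArrowSpaceFromOne ∘ₗ S.coactFromOne =
          S.coactFromOne.lTensor (MonoidAlgebra k G) ∘ₗ S.coactFromOne from
      LinearMap.congr_fun this v
    refine c.hom_ext_one fun C i y h w => ?_
    simp [coactFromOne_arrowVecOne]
  compat a v := by
    induction a using MonoidAlgebra.induction_linear with
    | zero => simp
    | add f g hf hg => simp [hf, hg]
    | single g t =>
      rw [show MonoidAlgebra.single g t = t • MonoidAlgebra.single g (1 : k) by simp]
      simp only [map_smul, LinearMap.smul_apply]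
      congr 1
      suffices S.coactFromOne ∘ₗ c.adjointAlgHom (MonoidAlgebra.single g (1 : k)) =
          ydTwist k (MonoidAlgebra k G) c.adjointAlgHom
            (Coalgebra.comul.lTensor (MonoidAlgebra k G)
              (Coalgebra.comul (R := k) (MonoidAlgebra.single g (1 : k)))) ∘ₗ S.coactFromOne from
        LinearMap.congr_fun this v
      refine c.hom_ext_one fun C i y h w => ?_
      simp [coactFromOne_arrowVecOne, adjointAlgHom_single, adjointFromOne_arrowVecOne,
        ydTwist_tmul, MonoidAlgebra.single_mul_single, mul_assoc]

end Arrows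

end RSR

end

/-! For (i), a coaction of $kG$ on $N$ is a grading $N=\bigoplus_g N_g$, and Yetter–Drinfeld
compatibility says that $h$ maps $N_g$ onto $N_{hgh^{-1}}$. So $N$ is determined by one component
$N_{u(C)}$ per conjugacy class, with its right action $w\cdot z=z^{-1}w$ of the centralizer of
$u(C)$. The order of that centralizer is invertible in $k$, so by Maschke $N_{u(C)}$ is a direct sum
of irreducibles, in any dimension. These summands form the ramification system. Whatever bases and
coset representatives are chosen, $a_{y,1}^{(i,j)}\mapsto g_\theta^{-1}\cdot x_C^{(i,j)}$, where
$y=g_\theta^{-1}u(C)g_\theta$, sends a basis to a basis. It is equivariant because $g_\theta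
g^{-1}=\zeta_\theta(g^{-1})g_{\theta'}$ gives
$gg_\theta^{-1}=g_{\theta'}^{-1}\zeta_\theta(g^{-1})^{-1}$ (`arrowBasis_isHom`).

For (ii), being a Nichols algebra of $N$ depends only on the isomorphism class of $N$, so by (i) it
suffices that two Nichols algebras $R$, $R'$ of the same $V$ are isomorphic
(`IsNicholsAlgebra.isomorphic`). No model of $\mathcal B(V)$ is constructed. Instead let $D:R\to
R\otimes R(1)$ be the component of $\Delta$ whose second leg has degree one. Two facts carry the
proof. First, $D$ is injective on each $R(n)$, $n>0$, because an element of $R(n)$ killed by $D$ is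
primitive as soon as $n\ge 2$ (`eq_zero_of_rightDiff`). Second, $D(av)=a\otimes v+D(a)\cdot v$ for
$v\in R(1)$, where the last product is twisted by the braiding (`rightDiff_mul`), so $D$ is computed
by one recursion in $R$ and in $R'$.

Let $L\subseteq R\times R'$ be the graph of the identification $R(1)\cong V\cong R'(1)$. The
recursion lifts $D$ on $L^n$ to $L^{n-1}\otimes V$, and induction on $n$ shows that $(0,b)\in L^n$
forces $b=0$. Hence the algebra generated by $L$ is the graph of an algebra map $R\to R'$. By
symmetry it is invertible, and its compatibility with action, coaction, counit and comultiplication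
is checked on generators. -/

noncomputable section

/-! ### Decomposition into irreducible subrepresentations -/

section Semisimple

variable {k : Type*} [Field k] {G : Type*} [Monoid G] {V : Type*} [AddCommGroup V] [Module k V]
  {ρ : Representation k G V}

/-- The image in `V` of a subrepresentation of a subrepresentation of `V`. -/
def Subrepresentation.mapSubtype (σ : Subrepresentation ρ)
    (τ : Subrepresentation σ.toRepresentation) : Subrepresentation ρ where
  toSubmodule := τ.toSubmodule.map σ.toSubmodule.subtype
  apply_mem_toSubmodule g := by
    rintro _ ⟨v, hv, rfl⟩
    exact ⟨_, τ.apply_mem_toSubmodule g hv, rfl⟩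

/-- Through `mapSubtype`, subrepresentations of `σ` embed into those of `ρ` lying below `σ`, and
below an atom there are only `⊥` and `σ`. -/
theorem Subrepresentation.isIrreducible_toRepresentation {σ : Subrepresentation ρ}
    (hσ : IsAtom σ) : σ.toRepresentation.IsIrreducible := by
  have inj := Submodule.map_injective_of_injective σ.toSubmodule.subtype_injective
  refine { exists_pair_ne := ⟨⊥, ⊤, fun h => hσ.1 ?_⟩, eq_bot_or_eq_top := fun τ => ?_ }
  · apply Subrepresentation.toSubmodule_injective
    have h' := congrArg (fun τ => Submodule.map σ.toSubmodule.subtype τ.toSubmodule) h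
    have h1 : (⊥ : Subrepresentation σ.toRepresentation).toSubmodule = ⊥ := rfl
    have h2 : (⊤ : Subrepresentation σ.toRepresentation).toSubmodule = ⊤ := rfl
    simp only [h1, h2, Submodule.map_bot, Submodule.map_subtype_top] at h'
    exact h'.symm
  · have hle : σ.mapSubtype τ ≤ σ := by
      rintro _ ⟨v, -, rfl⟩
      exact v.2
    rcases hσ.le_iff.1 hle with h | h
    · refine Or.inl (Subrepresentation.toSubmodule_injective (inj ?_))
      exact (congrArg Subrepresentation.toSubmodule h).trans (Submodule.map_bot _).symm
    · refine Or.inr (Subrepresentation.toSubmodule_injective (inj ?_))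
      exact (congrArg Subrepresentation.toSubmodule h).trans (Submodule.map_subtype_top _).symm

open scoped MonoidAlgebra in
/-- A representation of a finite group over a field whose characteristic does not divide the
group order is the internal direct sum of irreducible subrepresentations. -/
theorem Representation.exists_isInternal_irreducible {k : Type*} [Field k] {G : Type*} [Group G]
    [Finite G] [NeZero (Nat.card G : k)] {V : Type v} [AddCommGroup V] [Module k V]
    (ρ : Representation k G V) :
    ∃ (I : Type v) (A : I → Subrepresentation ρ), (∀ i, (A i).toRepresentation.IsIrreducible) ∧
      ∀ [DecidableEq I], DirectSum.IsInternal fun i => (A i).toSubmodule := by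
  -- Maschke: the group order is nonzero in `k`, so every `k[G]`-module is semisimple, with no
  -- restriction on dimension.
  obtain ⟨s, hs, htop, hsimple⟩ :=
    IsSemisimpleModule.exists_sSupIndep_sSup_simples_eq_top k[G] ρ.asModule
  refine ⟨s, fun i => Subrepresentation.ofSubmodule' i.1, fun i => ?_, ?_⟩
  · apply Subrepresentation.isIrreducible_toRepresentation
    have h := isSimpleModule_iff_isAtom.1 (hsimple i.1 i.2)
    exact (Subrepresentation.subrepresentationSubmoduleOrderIso (ρ := ρ)).symm.isAtom_iff i.1 |>.2 h
  · intro _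
    have h := DirectSum.isInternal_submodule_of_iSupIndep_of_iSup_eq_top
      ((sSupIndep_iff s).1 hs) (by rw [← sSup_eq_iSup', htop])
    exact h

end Semisimple

/-! ### Homogeneous components of a Yetter–Drinfeld module over a group algebra -/

namespace YetterDrinfeld

variable {k : Type*} [Field k] {G : Type*} [Group G] {N : Type*} [AddCommGroup N] [Module k N]
  (Y : YetterDrinfeld k (MonoidAlgebra k G) N)

/-- The homogeneous component `N_g = {n | δ(n) = g ⊗ n}`. -/
def homog (g : G) : Submodule k N :=
  LinearMap.eqLocus Y.coact (TensorProduct.mk k (MonoidAlgebra k G) N (MonoidAlgebra.single g 1))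

variable {Y} in
theorem mem_homog {g : G} {n : N} :
    n ∈ Y.homog g ↔ Y.coact n = MonoidAlgebra.single g (1 : k) ⊗ₜ n := Iff.rfl

/-- The coefficient functional `k[G] → k` at `g`. -/
def coeffAt (k : Type*) [Field k] {G : Type*} (g : G) : MonoidAlgebra k G →ₗ[k] k :=
  Finsupp.lapply g ∘ₗ (MonoidAlgebra.coeffLinearEquiv k).toLinearMap

@[simp]
theorem coeffAt_single {G : Type*} [DecidableEq G] (g h : G) (t : k) :
    coeffAt k g (MonoidAlgebra.single h t) = if h = g then t else 0 := by
  simp [coeffAt, Finsupp.single_apply]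

/-- The projection of `N` to the homogeneous component `N_g`. -/
def proj (g : G) : N →ₗ[k] N :=
  (TensorProduct.lid k N).toLinearMap ∘ₗ (coeffAt k g).rTensor N ∘ₗ Y.coact

theorem proj_of_mem [DecidableEq G] {g h : G} {n : N} (hn : n ∈ Y.homog h) :
    Y.proj g n = if h = g then n else 0 := by
  rw [mem_homog] at hn
  simp only [proj, LinearMap.comp_apply, hn, LinearMap.rTensor_tmul, coeffAt_single]
  split_ifs <;> simp

/-- A tensor in `k[G] ⊗ N` is determined by its coefficients. -/
theorem sum_single_tmul_coeff {G : Type*} [Fintype G] (t : MonoidAlgebra k G ⊗[k] N) :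
    ∑ g, MonoidAlgebra.single g (1 : k) ⊗ₜ[k]
      TensorProduct.lid k N ((coeffAt k g).rTensor N t) = t := by
  classical
  induction t with
  | zero => simp
  | add x y hx hy => simp only [map_add, TensorProduct.tmul_add, Finset.sum_add_distrib, hx, hy]
  | tmul a n =>
    induction a using MonoidAlgebra.induction_linear with
    | zero => simp
    | add x y hx hy =>
      simp only [map_add, TensorProduct.add_tmul, TensorProduct.tmul_add,
        Finset.sum_add_distrib, hx, hy]
    | single h c =>
      simp only [LinearMap.rTensor_tmul, coeffAt_single, TensorProduct.lid_tmul, ite_smul,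
        zero_smul]
      rw [Finset.sum_eq_single h (fun b _ hb => by simp [hb.symm]) (by simp)]
      rw [if_pos rfl, ← TensorProduct.smul_tmul]
      simp

theorem coact_eq_sum [Fintype G] (n : N) :
    Y.coact n = ∑ g, MonoidAlgebra.single g (1 : k) ⊗ₜ[k] Y.proj g n :=
  (sum_single_tmul_coeff _).symm

theorem sum_proj [Fintype G] (n : N) : ∑ g, Y.proj g n = n := by
  have h := Y.coact_counit n
  rw [coact_eq_sum] at h
  simpa using h

/-- Coassociativity applied to $\delta(n)=\sum_g g\otimes n_g$ reads $\sum_g g\otimes g\otimes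
n_g=\sum_g g\otimes\delta(n_g)$; compare the coefficients of $g$ in the first factor. -/
theorem proj_mem [Finite G] (g : G) (n : N) : Y.proj g n ∈ Y.homog g := by
  classical
  have := Fintype.ofFinite G
  have h := Y.coact_coassoc n
  rw [coact_eq_sum] at h
  have h' := congrArg (fun t => TensorProduct.lid k _ ((coeffAt k g).rTensor _ t)) h
  simp only [map_sum, LinearMap.rTensor_tmul, LinearMap.lTensor_tmul, MonoidAlgebra.comul_single,
    CommSemiring.comul_apply, TensorProduct.map_tmul, TensorProduct.assoc_tmul, coeffAt_single,
    TensorProduct.lid_tmul, ite_smul, one_smul, zero_smul, MonoidAlgebra.lsingle_apply,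
    Finset.sum_ite_eq', Finset.mem_univ, if_true] at h'
  exact h'.symm

/-- The projections recover the components of a sum, which gives independence. The components span
because the counit is 1 on every group element, so that $n=\sum_g n_g$. -/
theorem isInternal_homog [Finite G] [DecidableEq G] : DirectSum.IsInternal Y.homog := by
  have := Fintype.ofFinite G
  constructor
  · rw [injective_iff_map_eq_zero]
    intro x hx
    ext g
    have key : ∀ x : DirectSum G fun g => Y.homog g,
        Y.proj g (DirectSum.coeAddMonoidHom Y.homog x) = x g := by
      intro x
      induction x using DirectSum.induction_on with
      | zero => simp
      | of h n =>
        rw [DirectSum.coeAddMonoidHom_of, Y.proj_of_mem n.2, DirectSum.coe_of_apply]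
        split_ifs <;> rfl
      | add x y hx hy => simp [hx, hy]
    rw [← key, hx]
    simp
  · intro n
    refine ⟨∑ g, DirectSum.of (fun g => Y.homog g) g ⟨_, Y.proj_mem g n⟩, ?_⟩
    simp [sum_proj]

/-- For the grouplike $h$ the compatibility condition becomes $\delta(h\cdot n)=hgh^{-1}\otimes
h\cdot n$. -/
theorem act_mem_homog {g : G} {n : N} (hn : n ∈ Y.homog g) (h : G) :
    Y.act (MonoidAlgebra.single h 1) n ∈ Y.homog (h * g * h⁻¹) := by
  rw [mem_homog] at hn ⊢
  rw [Y.compat, hn]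
  simp [ydTwist_tmul, MonoidAlgebra.single_mul_single, mul_assoc]

theorem act_single_mul (g h : G) (n : N) :
    Y.act (MonoidAlgebra.single (g * h) 1) n =
      Y.act (MonoidAlgebra.single g 1) (Y.act (MonoidAlgebra.single h 1) n) := by
  rw [← Module.End.mul_apply, ← map_mul, MonoidAlgebra.single_mul_single, mul_one]

theorem act_single_one (n : N) : Y.act (MonoidAlgebra.single 1 1) n = n := by
  rw [← MonoidAlgebra.one_def, map_one, Module.End.one_apply]

/-- The right representation of the centralizer of `u` on `N_u`, with `w · z = z⁻¹ · w`. -/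
def centralizerRep (u : G) :
    Representation k (Subgroup.centralizer {u})ᵐᵒᵖ (Y.homog u) where
  toFun z := (Y.act (MonoidAlgebra.single ((z.unop⁻¹ : Subgroup.centralizer {u}) : G) 1)).restrict
    fun n hn => by
      have h := Y.act_mem_homog hn ((z.unop⁻¹ : Subgroup.centralizer {u}) : G)
      have hz := (z.unop⁻¹ : Subgroup.centralizer {u}).2
      rw [Subgroup.mem_centralizer_singleton_iff] at hz
      rwa [hz, mul_inv_cancel_right] at h
  map_one' := by
    ext n
    simp [act_single_one]
  map_mul' a b := by
    ext n
    simp [act_single_mul]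

theorem centralizerRep_apply (u : G) (z : Subgroup.centralizer {u}) (n : Y.homog u) :
    (Y.centralizerRep u (MulOpposite.op z) n : N) =
      Y.act (MonoidAlgebra.single (z : G)⁻¹ 1) n := by
  simp [centralizerRep]

/-- Acting by `h` identifies `N_g` with `N_{hgh⁻¹}`. -/
def homogEquiv {g g' : G} (h : G) (hg : h * g * h⁻¹ = g') : Y.homog g ≃ₗ[k] Y.homog g' where
  toFun n := ⟨Y.act (MonoidAlgebra.single h 1) n, hg ▸ Y.act_mem_homog n.2 h⟩
  map_add' _ _ := by ext; simp
  map_smul' _ _ := by ext; simp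
  invFun n := ⟨Y.act (MonoidAlgebra.single h⁻¹ 1) n, by
    have := Y.act_mem_homog n.2 h⁻¹
    rwa [show h⁻¹ * g' * h⁻¹⁻¹ = g by rw [← hg]; group] at this⟩
  left_inv n := by ext; simp [← act_single_mul, act_single_one]
  right_inv n := by ext; simp [← act_single_mul, act_single_one]

end YetterDrinfeld

/-! ### The arrow module of a Yetter–Drinfeld module -/

/-- The inverse of a bijective morphism of Yetter–Drinfeld modules is a morphism. -/
theorem YetterDrinfeld.IsHom.symm {k : Type*} [Field k] {H : Type*} [Ring H] [HopfAlgebra k H]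
    {V : Type*} [AddCommGroup V] [Module k V] {W : Type*} [AddCommGroup W] [Module k W]
    {X : YetterDrinfeld k H V} {Y : YetterDrinfeld k H W} {e : V ≃ₗ[k] W}
    (he : X.IsHom Y e) : Y.IsHom X e.symm := by
  refine ⟨fun h v => ?_, fun v => ?_⟩
  · apply e.injective
    have := he.1 h (e.symm v)
    simp_all
  · obtain ⟨v, rfl⟩ := e.surjective v
    have := he.2 v
    simp only [LinearEquiv.coe_coe] at this ⊢
    rw [this, ← LinearMap.comp_apply, ← LinearMap.lTensor_comp]
    simp

namespace RSR

variable {k : Type u₁} [Field k] {G : Type u₂} [Group G]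

theorem one_inv_mul_mem_carrier (y : G) : 1⁻¹ * y ∈ (ConjClasses.mk y).carrier := by
  rw [inv_one, one_mul]
  exact ConjClasses.mem_carrier_mk

/-- The arrows starting at `1`, sorted by their end vertices. -/
def arrowsFromOneEquiv (S : RSR.{u₁, u₂, v} k G) :
    (Σ y : G, Σ i : S.I (ConjClasses.mk y), S.J _ i) ≃ S.ArrowsFromOne :=
  Equiv.ofBijective
    (fun p => ⟨⟨ConjClasses.mk p.1, p.2.1, p.2.2, 1, p.1, one_inv_mul_mem_carrier p.1⟩, rfl⟩) <| by
    constructor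
    · rintro ⟨y, i, j⟩ ⟨y', i', j'⟩ h
      have h := Subtype.ext_iff.1 h
      simp only [RSR.Arrow.mk.injEq] at h
      obtain rfl : y = y' := h.2.2.2.2
      simpa using h
    · rintro ⟨⟨C, i, j, x, y, h⟩, hx⟩
      obtain rfl : x = 1 := hx
      have h' := h
      rw [inv_one, one_mul, ConjClasses.mem_carrier_iff_mk_eq] at h'
      subst h'
      exact ⟨⟨y, i, j⟩, rfl⟩

variable {S : RSR.{u₁, u₂, v} k G} (c : S.Choices)

theorem Choices.theta_inv_conj {C : ConjClasses G} {y : G} (h : 1⁻¹ * y ∈ C.carrier) :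
    (c.theta h : G)⁻¹ * S.u C * (c.theta h : G)⁻¹⁻¹ = y := by
  rw [inv_inv, ← c.theta_spec h, inv_one, one_mul]

variable {N : Type*} [AddCommGroup N] [Module k N] {Y : YetterDrinfeld k (MonoidAlgebra k G) N}
  (f : ∀ C (i : S.I C), S.X C i →ₗ[k] Y.homog (S.u C))
  (hinj : ∀ C i, Function.Injective (f C i))

open scoped Classical in
/-- The basis of `N` obtained by transporting the bases of the summands `X_C^{(i)}` of `N_{u(C)}`
to all homogeneous components. -/
def Choices.arrowBasis [Finite G]
    (hint : ∀ C, DirectSum.IsInternal fun i => LinearMap.range (f C i)) :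
    Module.Basis S.ArrowsFromOne k N :=
  (Y.isInternal_homog.collectedBasis fun y =>
    ((hint (ConjClasses.mk y)).collectedBasis fun i =>
      (c.basis (ConjClasses.mk y) i).map (LinearEquiv.ofInjective _ (hinj _ i))).map
      (Y.homogEquiv _ (c.theta_inv_conj (one_inv_mul_mem_carrier y)))).reindex
    S.arrowsFromOneEquiv

variable {f hinj}

-- A basis-free description of the coordinate isomorphism: valid for every vector `w`, it can be
-- applied after a centralizer element has moved `w` out of the chosen basis.
open scoped Classical in
theorem Choices.arrowBasis_repr_symm [Finite G]
    (hint : ∀ C, DirectSum.IsInternal fun i => LinearMap.range (f C i))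
    {C : ConjClasses G} (i : S.I C) (y : G) (h : 1⁻¹ * y ∈ C.carrier) (w : S.X C i) :
    (c.arrowBasis f hinj hint).repr.symm (c.arrowVecOne i y h w) =
      Y.act (MonoidAlgebra.single (c.theta h : G)⁻¹ 1) (f C i w) := by
  have h' := h
  rw [inv_one, one_mul, ConjClasses.mem_carrier_iff_mk_eq] at h'
  subst h'
  suffices H : (c.arrowBasis f hinj hint).repr.symm.toLinearMap ∘ₗ c.arrowVecOne i y h =
      Y.act (MonoidAlgebra.single (c.theta h : G)⁻¹ 1) ∘ₗ (Y.homog _).subtype ∘ₗ f _ i from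
    LinearMap.congr_fun H w
  refine (c.basis _ i).ext fun j => ?_
  rw [LinearMap.comp_apply, c.arrowVecOne_basis]
  have key : (⟨⟨ConjClasses.mk y, i, j, 1, y, h⟩, rfl⟩ : S.ArrowsFromOne) =
      S.arrowsFromOneEquiv ⟨y, i, j⟩ := rfl
  rw [LinearEquiv.coe_coe, Module.Basis.repr_symm_single_one, key, arrowBasis,
    Module.Basis.reindex_apply, Equiv.symm_apply_apply, DirectSum.IsInternal.collectedBasis_coe]
  simp only [Module.Basis.map_apply, DirectSum.IsInternal.collectedBasis_coe]
  rfl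

open scoped Classical in
theorem Choices.arrowBasis_isHom [Finite G]
    (hint : ∀ C, DirectSum.IsInternal fun i => LinearMap.range (f C i))
    (hf : ∀ C i z w, (f C i (S.ρ C i (MulOpposite.op z) w) : N) =
      Y.act (MonoidAlgebra.single (z : G)⁻¹ 1) (f C i w)) :
    c.ydFromOne.IsHom Y (c.arrowBasis f hinj hint).repr.symm := by
  constructor
  · intro a v
    induction a using MonoidAlgebra.induction_linear with
    | zero => simp
    | add f g hf hg => simp only [map_add, LinearMap.add_apply, hf, hg]
    | single g t =>
      rw [show MonoidAlgebra.single g t = t • MonoidAlgebra.single g (1 : k) by simp]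
      simp only [map_smul, LinearMap.smul_apply]
      congr 1
      suffices H : (c.arrowBasis f hinj hint).repr.symm.toLinearMap ∘ₗ c.adjointFromOne g =
          Y.act (MonoidAlgebra.single g 1) ∘ₗ (c.arrowBasis f hinj hint).repr.symm.toLinearMap by
        have := LinearMap.congr_fun H v
        rwa [← c.adjointAlgHom_single] at this
      refine c.hom_ext_one fun C i y h w => ?_
      simp only [LinearMap.comp_apply, LinearEquiv.coe_coe]
      rw [c.adjointFromOne_arrowVecOne, c.arrowBasis_repr_symm, c.arrowBasis_repr_symm, hf,
        ← Y.act_single_mul, ← Y.act_single_mul]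
      congr 3
      -- What remains is $g_{\theta'}^{-1}\zeta_\theta(g^{-1})^{-1}=gg_\theta^{-1}$, the inverse of
      -- the defining relation of $\zeta_\theta(g^{-1})$.
      have h2 := c.zeta_mul (c.theta h) g⁻¹
      rw [← c.theta_right] at h2
      have h3 : c.theta (mem_adj h g) = c.theta (mem_right h g⁻¹) := by
        apply c.theta_unique
        rw [← c.theta_spec (mem_adj h g), ← c.theta_spec (mem_right h g⁻¹)]
        group
      rw [h3, ← mul_inv_rev, h2, mul_inv_rev, inv_inv]
  · intro v
    suffices H : Y.coact ∘ₗ (c.arrowBasis f hinj hint).repr.symm.toLinearMap =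
        (c.arrowBasis f hinj hint).repr.symm.toLinearMap.lTensor (MonoidAlgebra k G) ∘ₗ
          S.coactFromOne from LinearMap.congr_fun H v
    refine c.hom_ext_one fun C i y h w => ?_
    simp only [LinearMap.comp_apply, c.coactFromOne_arrowVecOne, LinearMap.lTensor_tmul,
      LinearEquiv.coe_coe, c.arrowBasis_repr_symm]
    -- The image $g_\theta^{-1}\cdot w$ has degree $g_\theta^{-1}u(C)g_\theta=y$, the end vertex of
    -- the arrow.
    have := Y.act_mem_homog (f C i w).2 (c.theta h : G)⁻¹
    rw [c.theta_inv_conj] at this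
    exact this

end RSR

/-! ### The ramification system of a Yetter–Drinfeld module -/

namespace YetterDrinfeld

variable {k : Type u₁} [Field k] {G : Type u₂} [Group G] {N : Type v} [AddCommGroup N]
  [Module k N] (Y : YetterDrinfeld k (MonoidAlgebra k G) N)

/-- The ramification system given by families of irreducible subrepresentations of the components
`N_{u(C)}`, where `u(C)` is a chosen representative of `C`. -/
def rsr (I : ConjClasses G → Type v)
    (A : ∀ C, I C → Subrepresentation (Y.centralizerRep (Quotient.out C)))
    (hA : ∀ C i, (A C i).toRepresentation.IsIrreducible) : RSR.{u₁, u₂, v} k G where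
  r C := Cardinal.mk (Σ i : I C, Module.Free.ChooseBasisIndex k (A C i).toSubmodule)
  u C := Quotient.out C
  u_mem C := ConjClasses.mem_carrier_iff_mk_eq.2 (Quotient.out_eq C)
  I := I
  J C i := Module.Free.ChooseBasisIndex k (A C i).toSubmodule
  X C i := (A C i).toSubmodule
  ρ C i := (A C i).toRepresentation
  irreducible := hA
  card_J C i := (Module.Free.chooseBasis k (A C i).toSubmodule).mk_eq_rank''
  card_I _ := rfl

theorem exists_rsr_isomorphic [Finite G] (hchar : ¬ ringChar k ∣ Nat.card G) :
    ∃ S : RSR.{u₁, u₂, v} k G, ∀ c : S.Choices, Y.Isomorphic c.ydFromOne := by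
  classical
  have hfin (u : G) : Finite (Subgroup.centralizer {u})ᵐᵒᵖ :=
    Finite.of_equiv _ MulOpposite.opEquiv
  have hne (u : G) : NeZero (Nat.card (Subgroup.centralizer {u})ᵐᵒᵖ : k) := by
    refine ⟨fun h => hchar ?_⟩
    rw [Nat.card_congr MulOpposite.opEquiv.symm, ringChar.spec] at h
    exact h.trans (Subgroup.card_subgroup_dvd_card _)
  choose I A hA hint using fun C : ConjClasses G =>
    (Y.centralizerRep (Quotient.out C)).exists_isInternal_irreducible
  -- The system is fixed before the choices `c`; the maps `f` are the inclusions of the irreducible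
  -- summands into the components of `N`.
  refine ⟨Y.rsr I A hA, fun c => ⟨_, IsHom.symm (c.arrowBasis_isHom
    (f := fun C i => (A C i).toSubmodule.subtype)
    (hinj := fun C i => (A C i).toSubmodule.subtype_injective) (fun C => ?_) ?_)⟩⟩
  · have e : (fun i => LinearMap.range (A C i).toSubmodule.subtype) =
        fun i => (A C i).toSubmodule := funext fun i => Submodule.range_subtype _
    exact e ▸ hint C
  · intro C i z w
    exact Y.centralizerRep_apply _ z _

end YetterDrinfeld

/-! ### Projections and the comultiplication of a graded braided Hopf algebra -/

namespace GradedBraidedHopfAlgebra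

variable {k : Type*} [Field k] {H : Type*} [Ring H] [HopfAlgebra k H]
  (R : GradedBraidedHopfAlgebra.{_, _, w} k H)

/-- The decomposition of the elements of `R` into homogeneous components. -/
def decomp : R.carrier ≃ₗ[k] DirectSum ℕ fun n => R.comp n :=
  (LinearEquiv.ofBijective (DirectSum.coeLinearMap R.comp)
    (show Function.Bijective (DirectSum.coeLinearMap R.comp) from R.isInternal)).symm

theorem decomp_of_mem {n : ℕ} {a : R.carrier} (ha : a ∈ R.comp n) :
    R.decomp a = DirectSum.lof k ℕ (fun n => R.comp n) n ⟨a, ha⟩ := by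
  rw [decomp, LinearEquiv.symm_apply_eq, LinearEquiv.ofBijective_apply,
    DirectSum.coeLinearMap_lof]

/-- The projection of `R` to `R(n)`. -/
def projComp (n : ℕ) : R.carrier →ₗ[k] R.comp n :=
  DirectSum.component k ℕ (fun n => R.comp n) n ∘ₗ R.decomp.toLinearMap

/-- The projection of `R` to `R(n)`, as an endomorphism of `R`. -/
def pr (n : ℕ) : R.carrier →ₗ[k] R.carrier := (R.comp n).subtype ∘ₗ R.projComp n

variable {R}

theorem pr_mem (n : ℕ) (a : R.carrier) : R.pr n a ∈ R.comp n := (R.projComp n a).2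

theorem pr_of_mem {m : ℕ} (n : ℕ) {a : R.carrier} (ha : a ∈ R.comp m) :
    R.pr n a = if m = n then a else 0 := by
  simp only [pr, projComp, LinearMap.comp_apply, LinearEquiv.coe_coe, R.decomp_of_mem ha]
  split_ifs with h
  · subst h
    rw [DirectSum.component.lof_self]
    rfl
  · rw [DirectSum.component.of, dif_neg h, map_zero]

theorem pr_self {n : ℕ} {a : R.carrier} (ha : a ∈ R.comp n) : R.pr n a = a := by
  rw [pr_of_mem n ha, if_pos rfl]

theorem hom_ext {W : Type*} [AddCommGroup W] [Module k W] {F F' : R.carrier →ₗ[k] W}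
    (h : ∀ n, ∀ a ∈ R.comp n, F a = F' a) : F = F' := by
  have : (⊤ : Submodule k R.carrier) ≤ LinearMap.eqLocus F F' := by
    rw [← R.isInternal.submodule_iSup_eq_top]
    exact iSup_le h
  exact LinearMap.ext fun a => this trivial

theorem eq_zero_of_pr {a : R.carrier} (h : ∀ n, R.pr n a = 0) : a = 0 := by
  rw [← R.decomp.map_eq_zero_iff]
  ext n
  exact h n

theorem comul_ext {W : Type*} [AddCommGroup W] [Module k W]
    {F F' : R.carrier ⊗[k] R.carrier →ₗ[k] W} {n : ℕ} {a : R.carrier} (ha : a ∈ R.comp n)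
    (h : ∀ p q, p + q = n → ∀ x ∈ R.comp p, ∀ y ∈ R.comp q, F (x ⊗ₜ y) = F' (x ⊗ₜ y)) :
    F (Coalgebra.comul (R := k) a) = F' (Coalgebra.comul (R := k) a) := by
  have hle : (⨆ p ∈ Finset.HasAntidiagonal.antidiagonal n,
      LinearMap.range (TensorProduct.map (R.comp p.1).subtype (R.comp p.2).subtype)) ≤
      LinearMap.eqLocus F F' := by
    refine iSup₂_le fun p hp => ?_
    rintro _ ⟨t, rfl⟩
    suffices F ∘ₗ TensorProduct.map (R.comp p.1).subtype (R.comp p.2).subtype =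
        F' ∘ₗ TensorProduct.map (R.comp p.1).subtype (R.comp p.2).subtype from
      LinearMap.congr_fun this t
    ext x y
    exact h p.1 p.2 (Finset.HasAntidiagonal.mem_antidiagonal.1 hp) x x.2 y y.2
  exact hle (R.comul_mem ha)

/-- The component `R → R ⊗ R(1)` of the comultiplication. -/
def rightDiff (R : GradedBraidedHopfAlgebra.{_, _, w} k H) :
    R.carrier →ₗ[k] R.carrier ⊗[k] R.carrier :=
  (R.pr 1).lTensor R.carrier ∘ₗ Coalgebra.comul

/-- In $\Delta(a)$ with $a$ of degree $n$, a second leg of degree 1 leaves degree $n-1$ for the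
first leg. -/
theorem rightDiff_pr_succ (j : ℕ) :
    R.rightDiff ∘ₗ R.pr (j + 1) = (R.pr j).rTensor R.carrier ∘ₗ R.rightDiff := by
  refine hom_ext fun n a ha => ?_
  have h : (R.pr j).rTensor R.carrier (R.rightDiff a) =
      if n = j + 1 then R.rightDiff a else 0 := by
    have h0 := comul_ext ha (F := (R.pr j).rTensor R.carrier ∘ₗ (R.pr 1).lTensor R.carrier)
      (F' := if n = j + 1 then (R.pr 1).lTensor R.carrier else 0) (fun p q hpq x hx y hy => by
        simp only [LinearMap.comp_apply, LinearMap.lTensor_tmul, LinearMap.rTensor_tmul,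
          pr_of_mem _ hx, pr_of_mem _ hy]
        by_cases hq : q = 1
        · by_cases hp : p = j
          · rw [if_pos hq, if_pos hp, if_pos (by omega), LinearMap.lTensor_tmul, pr_of_mem _ hy,
              if_pos hq]
          · rw [if_neg hp, if_neg (show ¬ n = j + 1 by omega)]
            simp
        · rw [if_neg hq]
          split_ifs <;> simp [pr_of_mem _ hy, hq])
    rw [LinearMap.comp_apply] at h0
    simp only [rightDiff, LinearMap.comp_apply, h0]
    split_ifs <;> simp
  rw [LinearMap.comp_apply, LinearMap.comp_apply, h, pr_of_mem _ ha]
  split_ifs <;> simp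

theorem sum_lTensor_pr_comul {n : ℕ} {a : R.carrier} (ha : a ∈ R.comp n) :
    ∑ q ∈ Finset.range (n + 1), (R.pr q).lTensor R.carrier (Coalgebra.comul (R := k) a) =
      Coalgebra.comul (R := k) a := by
  have := comul_ext ha (F := ∑ q ∈ Finset.range (n + 1), (R.pr q).lTensor R.carrier)
    (F' := LinearMap.id) (fun p q hpq x hx y hy => by
      rw [LinearMap.sum_apply, Finset.sum_eq_single q]
      · simp [pr_self hy]
      · intro b _ hb
        simp [pr_of_mem _ hy, hb.symm]
      · intro hq
        simp only [Finset.mem_range] at hq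
        omega)
  simpa using this

/-- The two degrees add up to `n`, so the second is `n` exactly when the first is 0. In the
connected case this component is $1\otimes a$. -/
theorem lTensor_pr_comul_top {n : ℕ} {a : R.carrier} (ha : a ∈ R.comp n) :
    (R.pr n).lTensor R.carrier (Coalgebra.comul (R := k) a) =
      (R.pr 0).rTensor R.carrier (Coalgebra.comul (R := k) a) := by
  refine comul_ext ha fun p q hpq x hx y hy => ?_
  simp only [LinearMap.lTensor_tmul, LinearMap.rTensor_tmul, pr_of_mem _ hx, pr_of_mem _ hy]
  by_cases hp : p = 0
  · rw [if_pos hp, if_pos (by omega)]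
  · rw [if_neg hp, if_neg (by omega)]
    simp

/-- Coassociativity with the last of the three legs projected to `R(1)`. -/
theorem lTensor_rightDiff_comul (a : R.carrier) :
    R.rightDiff.lTensor R.carrier (Coalgebra.comul (R := k) a) =
      TensorProduct.assoc k R.carrier R.carrier R.carrier
        ((Coalgebra.comul (R := k)).rTensor R.carrier (R.rightDiff a)) := by
  rw [rightDiff, LinearMap.lTensor_comp, LinearMap.comp_apply, ← Coalgebra.coassoc_apply,
    LinearMap.comp_apply,
    ← LinearMap.comp_apply (LinearMap.rTensor _ _) (LinearMap.lTensor _ _),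
    LinearMap.rTensor_comp_lTensor, ← LinearMap.lTensor_comp_rTensor, LinearMap.comp_apply]
  generalize (Coalgebra.comul (R := k)).rTensor R.carrier (Coalgebra.comul (R := k) a) = t
  induction t with
  | zero => simp
  | add x y hx hy => simp only [map_add, hx, hy]
  | tmul x z =>
    induction x with
    | zero => simp
    | add x y hx hy => simp only [map_add, TensorProduct.add_tmul, hx, hy]
    | tmul x y => simp

/-! ### Injectivity of `rightDiff` in positive degree -/

section Connected

variable (h0 : R.comp 0 = Submodule.span k {1})
include h0

/-- Since the degree zero part is $k1$ and $\varepsilon$ kills positive degrees, the counit axioms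
compute the two extreme components of $\Delta$. -/
theorem pr_zero : R.pr 0 = LinearMap.toSpanSingleton k R.carrier 1 ∘ₗ Coalgebra.counit := by
  refine hom_ext fun n a ha => ?_
  rw [pr_of_mem _ ha]
  split_ifs with hn
  · subst hn
    rw [h0, Submodule.mem_span_singleton] at ha
    obtain ⟨t, rfl⟩ := ha
    simp [R.counit_one]
  · simp [R.counit_of_mem hn ha]

theorem lTensor_pr_zero_comul (a : R.carrier) :
    (R.pr 0).lTensor R.carrier (Coalgebra.comul (R := k) a) = a ⊗ₜ 1 := by
  rw [pr_zero h0, LinearMap.lTensor_comp, LinearMap.comp_apply, Coalgebra.lTensor_counit_comul]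
  simp

theorem rTensor_pr_zero_comul (a : R.carrier) :
    (R.pr 0).rTensor R.carrier (Coalgebra.comul (R := k) a) = 1 ⊗ₜ a := by
  rw [pr_zero h0, LinearMap.rTensor_comp, LinearMap.comp_apply, Coalgebra.rTensor_counit_comul]
  simp

/-- In a connected graded braided Hopf algebra whose primitive elements have degree one, an element
of positive degree is determined by its component in `R ⊗ R(1)`. -/
theorem eq_zero_of_rightDiff
    (hprim : ∀ a : R.carrier, Coalgebra.comul (R := k) a = a ⊗ₜ[k] 1 + 1 ⊗ₜ[k] a → a ∈ R.comp 1)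
    {n : ℕ} (hn : n ≠ 0) {a : R.carrier} (ha : a ∈ R.comp n) (hD : R.rightDiff a = 0) :
    a = 0 := by
  induction n using Nat.strong_induction_on generalizing a with
  | _ n ih =>
    by_cases hn1 : n = 1
    · subst hn1
      have h : (1 : R.carrier) ⊗ₜ[k] a = 0 := by
        rw [← rTensor_pr_zero_comul h0, ← lTensor_pr_comul_top ha]
        exact hD
      have h' := congrArg (fun t => TensorProduct.lid k _
        ((Coalgebra.counit (R := k)).rTensor R.carrier t)) h
      simpa [R.counit_one] using h'
    -- All intermediate components of $\Delta(a)$ vanish: by coassociativity, applying $D$ to the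
    -- second leg of such a component yields a projection of $(\Delta\otimes\mathrm{id})D(a)=0$, and
    -- $D$ is injective on `R(j)` by induction, also after tensoring with `R`.
    · have hz : ∀ j, j ≠ 0 → j ≠ n → j < n + 1 →
          (R.pr j).lTensor R.carrier (Coalgebra.comul (R := k) a) = 0 := by
        intro j hj0 hjn hj
        have h1 : R.rightDiff.lTensor R.carrier ((R.pr j).lTensor R.carrier
            (Coalgebra.comul (R := k) a)) = 0 := by
          obtain ⟨j, rfl⟩ := Nat.exists_eq_succ_of_ne_zero hj0
          rw [← LinearMap.comp_apply, ← LinearMap.lTensor_comp, rightDiff_pr_succ,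
            LinearMap.lTensor_comp, LinearMap.comp_apply, lTensor_rightDiff_comul, hD]
          simp
        rw [pr, LinearMap.lTensor_comp, LinearMap.comp_apply, ← LinearMap.comp_apply,
          ← LinearMap.lTensor_comp] at h1
        have hinj : Function.Injective (R.rightDiff ∘ₗ (R.comp j).subtype) := by
          rw [injective_iff_map_eq_zero]
          intro b hb
          exact Subtype.ext (ih j (by omega) hj0 b.2 hb)
        have h2 := (injective_iff_map_eq_zero _).1
          (Module.Flat.lTensor_preserves_injective_linearMap (M := R.carrier) _ hinj) _ h1
        rw [pr, LinearMap.lTensor_comp, LinearMap.comp_apply, h2, map_zero]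
      have hsum := sum_lTensor_pr_comul ha
      rw [Finset.sum_range_succ, Finset.sum_eq_single 0 (fun j hj hj0 => by
        rw [Finset.mem_range] at hj
        exact hz j hj0 (by omega) (by omega)) (fun h => absurd (Finset.mem_range.2 (by omega)) h),
        lTensor_pr_zero_comul h0, lTensor_pr_comul_top ha, rTensor_pr_zero_comul h0] at hsum
      -- Only $a\otimes 1+1\otimes a$ is left, so `a` is primitive and of degree 1 as well as `n ≠
      -- 1`.
      have h1 := hprim a hsum.symm
      have h2 := pr_of_mem 1 ha
      rwa [if_neg hn1, pr_self h1] at h2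

end Connected

end GradedBraidedHopfAlgebra

/-! ### Naturality of the braiding -/

namespace YetterDrinfeld

variable {k : Type*} [Field k] {H : Type*} [Ring H] [HopfAlgebra k H]
  {V : Type*} [AddCommGroup V] [Module k V] {W : Type*} [AddCommGroup W] [Module k W]
  {V' : Type*} [AddCommGroup V'] [Module k V'] {W' : Type*} [AddCommGroup W'] [Module k W']

/-- Written as a linear map applied to `X.coact v`, so that later proofs may replace the coaction by
an arbitrary tensor and use induction on it. -/
theorem braiding_tmul (X : YetterDrinfeld k H V) (Y : YetterDrinfeld k H W) (v : V) (w : W) :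
    X.braiding Y (v ⊗ₜ w) = (Y.act.toLinearMap.flip w).rTensor V (X.coact v) := by
  simp only [braiding, LinearMap.comp_apply, LinearMap.rTensor_tmul]
  generalize X.coact v = t
  induction t with
  | zero => simp
  | add x y hx hy => simp only [map_add, TensorProduct.add_tmul, hx, hy]
  | tmul h v => simp

/-- The braiding is natural. -/
theorem braiding_map {X : YetterDrinfeld k H V} {Y : YetterDrinfeld k H W}
    {X' : YetterDrinfeld k H V'} {Y' : YetterDrinfeld k H W'} {f : V →ₗ[k] V'} {g : W →ₗ[k] W'}
    (hf : ∀ v, X'.coact (f v) = f.lTensor H (X.coact v))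
    (hg : ∀ h w, g (Y.act h w) = Y'.act h (g w)) (t : V ⊗[k] W) :
    X'.braiding Y' (TensorProduct.map f g t) = TensorProduct.map g f (X.braiding Y t) := by
  induction t with
  | zero => simp
  | add x y hx hy => simp only [map_add, hx, hy]
  | tmul v w =>
    rw [TensorProduct.map_tmul, braiding_tmul, braiding_tmul, hf]
    generalize X.coact v = t
    induction t with
    | zero => simp
    | add x y hx hy => simp only [map_add, hx, hy]
    | tmul h v => simp [hg]

theorem midBraiding_tmul (X : YetterDrinfeld k H V) (a b c d : V) :
    X.midBraiding ((a ⊗ₜ b) ⊗ₜ (c ⊗ₜ d)) =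
      (TensorProduct.assoc k V V (V ⊗[k] V)).symm
        (a ⊗ₜ TensorProduct.assoc k V V V (X.braiding X (b ⊗ₜ c) ⊗ₜ d)) := by
  simp [midBraiding]

theorem midBraiding_map {X : YetterDrinfeld k H V} {X' : YetterDrinfeld k H V'}
    {f : V →ₗ[k] V'} (hf : X.IsHom X' f) (s t : V ⊗[k] V) :
    X'.midBraiding (TensorProduct.map f f s ⊗ₜ TensorProduct.map f f t) =
      TensorProduct.map (TensorProduct.map f f) (TensorProduct.map f f)
        (X.midBraiding (s ⊗ₜ t)) := by
  induction s with
  | zero => simp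
  | add x y hx hy => simp only [map_add, TensorProduct.add_tmul, hx, hy]
  | tmul a b =>
    induction t with
    | zero => simp
    | add x y hx hy => simp only [map_add, TensorProduct.tmul_add, hx, hy]
    | tmul c d =>
      rw [TensorProduct.map_tmul, TensorProduct.map_tmul, midBraiding_tmul, midBraiding_tmul,
        ← TensorProduct.map_tmul f f b c, braiding_map hf.2 hf.1]
      generalize X.braiding X (b ⊗ₜ c) = t
      induction t with
      | zero => simp
      | add x y hx hy => simp only [map_add, TensorProduct.tmul_add, TensorProduct.add_tmul, hx, hy]
      | tmul x y => simp

/-- The map `(P ⊗ V) ⊗ V → P ⊗ V`, `(x ⊗ y) ⊗ v ↦ x · (y₍₋₁₎ v) ⊗ y₍₀₎`, where `μ` multiplies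
elements of `P` by elements of `V` from the right. -/
def braidedMul (Y : YetterDrinfeld k H V) {P : Type*} [AddCommGroup P] [Module k P]
    (μ : P ⊗[k] V →ₗ[k] P) : (P ⊗[k] V) ⊗[k] V →ₗ[k] P ⊗[k] V :=
  μ.rTensor V ∘ₗ (TensorProduct.assoc k P V V).symm.toLinearMap ∘ₗ
    (Y.braiding Y).lTensor P ∘ₗ (TensorProduct.assoc k P V V).toLinearMap

/-- Serves to compare the twisted product over the abstract `V` with those inside `R` and `R'`, with
`p` one of the two coordinate projections. -/
theorem braidedMul_map {Y : YetterDrinfeld k H V} {Y' : YetterDrinfeld k H V'}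
    {P : Type*} [AddCommGroup P] [Module k P] {P' : Type*} [AddCommGroup P'] [Module k P']
    {μ : P ⊗[k] V →ₗ[k] P} {μ' : P' ⊗[k] V' →ₗ[k] P'} {f : V →ₗ[k] V'} (hf : Y.IsHom Y' f)
    {p : P →ₗ[k] P'} (hp : ∀ x v, μ' (p x ⊗ₜ f v) = p (μ (x ⊗ₜ v))) (t : P ⊗[k] V) (v : V) :
    Y'.braidedMul μ' (TensorProduct.map p f t ⊗ₜ f v) =
      TensorProduct.map p f (Y.braidedMul μ (t ⊗ₜ v)) := by
  induction t with
  | zero => simp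
  | add x y hx hy => simp only [map_add, TensorProduct.add_tmul, hx, hy]
  | tmul x y =>
    simp only [braidedMul, LinearMap.comp_apply, LinearEquiv.coe_coe, TensorProduct.map_tmul,
      TensorProduct.assoc_tmul, LinearMap.lTensor_tmul]
    rw [← TensorProduct.map_tmul f f y v, braiding_map hf.2 hf.1]
    generalize Y.braiding Y (y ⊗ₜ v) = t
    induction t with
    | zero => simp
    | add x y hx hy => simp only [map_add, TensorProduct.tmul_add, hx, hy]
    | tmul x y => simp [hp]

/-- `braidedMul` maps `(A ⊗ V) ⊗ V` to `B ⊗ V` if `A · V ⊆ B`. -/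
theorem braidedMul_mem (Y : YetterDrinfeld k H V) {P : Type*} [AddCommGroup P] [Module k P]
    {μ : P ⊗[k] V →ₗ[k] P} {A B : Submodule k P} (hAB : ∀ x ∈ A, ∀ v, μ (x ⊗ₜ v) ∈ B)
    {t : P ⊗[k] V} (ht : t ∈ LinearMap.range (A.subtype.rTensor V)) (v : V) :
    Y.braidedMul μ (t ⊗ₜ v) ∈ LinearMap.range (B.subtype.rTensor V) := by
  obtain ⟨t, rfl⟩ := ht
  induction t with
  | zero => simp
  | add x y hx hy =>
    simp only [map_add, TensorProduct.add_tmul]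
    exact add_mem hx hy
  | tmul x y =>
    simp only [braidedMul, LinearMap.comp_apply, LinearEquiv.coe_coe, LinearMap.rTensor_tmul,
      TensorProduct.assoc_tmul, LinearMap.lTensor_tmul]
    generalize Y.braiding Y (y ⊗ₜ v) = t
    induction t with
    | zero => simp
    | add x y hx hy =>
      simp only [map_add, TensorProduct.tmul_add]
      exact add_mem hx hy
    | tmul z y => exact ⟨⟨_, hAB x x.2 z⟩ ⊗ₜ y, by simp⟩

end YetterDrinfeld

/-! ### The product rule for `rightDiff` -/

namespace GradedBraidedHopfAlgebra

variable {k : Type*} [Field k] {H : Type*} [Ring H] [HopfAlgebra k H]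
  {R : GradedBraidedHopfAlgebra.{_, _, w} k H}

/-- `H` acts on 1 through its counit, and the counit axiom of the coaction then returns `y`. -/
theorem braiding_tmul_one (y : R.carrier) : R.yd.braiding R.yd (y ⊗ₜ 1) = 1 ⊗ₜ y := by
  have h : R.yd.act.toLinearMap.flip 1 =
      LinearMap.toSpanSingleton k R.carrier 1 ∘ₗ Coalgebra.counit := by
    ext h
    simp [R.act_one]
  have h2 := congrArg (TensorProduct.lid k R.carrier).symm (R.yd.coact_counit y)
  rw [LinearEquiv.symm_apply_apply, TensorProduct.lid_symm_apply] at h2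
  rw [YetterDrinfeld.braiding_tmul, h, LinearMap.rTensor_comp, LinearMap.comp_apply, h2]
  simp

/-- Each `R(n)` is a subcomodule. By naturality the projections therefore pass through the braiding
in the leg that coacts. -/
theorem coact_pr (n : ℕ) (a : R.carrier) :
    R.yd.coact (R.pr n a) = (R.pr n).lTensor H (R.yd.coact a) := by
  suffices R.yd.coact ∘ₗ R.pr n = (R.pr n).lTensor H ∘ₗ R.yd.coact from LinearMap.congr_fun this a
  refine hom_ext fun m a ha => ?_
  obtain ⟨t, ht⟩ := R.coact_mem ha
  have h : R.pr n ∘ₗ (R.comp m).subtype = if m = n then (R.comp m).subtype else 0 := by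
    ext x
    rw [LinearMap.comp_apply, Submodule.subtype_apply, pr_of_mem n x.2]
    split_ifs <;> simp
  rw [LinearMap.comp_apply, LinearMap.comp_apply, ← ht,
    ← LinearMap.comp_apply (LinearMap.lTensor _ _) (LinearMap.lTensor _ _),
    ← LinearMap.lTensor_comp, h, pr_of_mem n ha]
  split_ifs with hmn
  · exact ht.symm
  · simp

/-- This and the next lemma are the contributions of the two summands of $\Delta(v)=v\otimes
1+1\otimes v$ to $\Delta(a)\Delta(v)$. -/
theorem map_mul_midBraiding_tmul_one (t : R.carrier ⊗[k] R.carrier) (v : R.carrier) :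
    TensorProduct.map (LinearMap.mul' k R.carrier) (LinearMap.mul' k R.carrier)
      (R.yd.midBraiding (t ⊗ₜ (v ⊗ₜ 1))) = R.yd.braidedMul (LinearMap.mul' k R.carrier) (t ⊗ₜ v) := by
  induction t with
  | zero => simp
  | add x y hx hy => simp only [map_add, TensorProduct.add_tmul, hx, hy]
  | tmul x y =>
    rw [YetterDrinfeld.midBraiding_tmul]
    simp only [YetterDrinfeld.braidedMul, LinearMap.comp_apply, LinearEquiv.coe_coe,
      TensorProduct.assoc_tmul, LinearMap.lTensor_tmul]
    generalize R.yd.braiding R.yd (y ⊗ₜ v) = t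
    induction t with
    | zero => simp
    | add x y hx hy => simp only [map_add, TensorProduct.tmul_add, TensorProduct.add_tmul, hx, hy]
    | tmul x y => simp

theorem map_mul_midBraiding_one_tmul (t : R.carrier ⊗[k] R.carrier) (v : R.carrier) :
    TensorProduct.map (LinearMap.mul' k R.carrier) (LinearMap.mul' k R.carrier)
      (R.yd.midBraiding (t ⊗ₜ (1 ⊗ₜ v))) =
        ((LinearMap.mul k R.carrier).flip v).lTensor R.carrier t := by
  induction t with
  | zero => simp
  | add x y hx hy => simp only [map_add, TensorProduct.add_tmul, hx, hy]
  | tmul x y =>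
    rw [YetterDrinfeld.midBraiding_tmul, braiding_tmul_one]
    simp

theorem lTensor_pr_braidedMul (n : ℕ) (t : R.carrier ⊗[k] R.carrier) (v : R.carrier) :
    (R.pr n).lTensor R.carrier (R.yd.braidedMul (LinearMap.mul' k R.carrier) (t ⊗ₜ v)) =
      R.yd.braidedMul (LinearMap.mul' k R.carrier) ((R.pr n).lTensor R.carrier t ⊗ₜ v) := by
  induction t with
  | zero => simp
  | add x y hx hy => simp only [map_add, TensorProduct.add_tmul, hx, hy]
  | tmul x y =>
    simp only [YetterDrinfeld.braidedMul, LinearMap.comp_apply, LinearEquiv.coe_coe,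
      TensorProduct.assoc_tmul, LinearMap.lTensor_tmul]
    have h := YetterDrinfeld.braiding_map (X := R.yd) (X' := R.yd) (Y := R.yd) (Y' := R.yd)
      (g := LinearMap.id) (coact_pr n) (fun _ _ => rfl) (y ⊗ₜ v)
    rw [TensorProduct.map_tmul, LinearMap.id_apply] at h
    rw [h]
    generalize R.yd.braiding R.yd (y ⊗ₜ v) = t
    induction t with
    | zero => simp
    | add x y hx hy => simp only [map_add, TensorProduct.tmul_add, hx, hy]
    | tmul x y => simp

theorem pr_one_mul {v : R.carrier} (hv : v ∈ R.comp 1) :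
    R.pr 1 ∘ₗ (LinearMap.mul k R.carrier).flip v =
      (LinearMap.mul k R.carrier).flip v ∘ₗ R.pr 0 := by
  refine hom_ext fun n a ha => ?_
  simp only [LinearMap.comp_apply, LinearMap.flip_apply, LinearMap.mul_apply',
    pr_of_mem _ ha, pr_of_mem _ (R.mul_mem ha hv)]
  by_cases hn : n = 0 <;> simp [hn]

/-- Project the second leg of $\Delta(a)(v\otimes 1+1\otimes v)$ to degree one. The first summand
gives $D(a)$ times `v` after braiding. In the second, `v` already has degree one, so only the part
$a\otimes 1$ of $\Delta(a)$ survives. -/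
theorem rightDiff_mul (h0 : R.comp 0 = Submodule.span k {1}) (a : R.carrier) {v : R.carrier}
    (hv : v ∈ R.comp 1) (hprim : Coalgebra.comul (R := k) v = v ⊗ₜ[k] 1 + 1 ⊗ₜ[k] v) :
    R.rightDiff (a * v) =
      a ⊗ₜ v + R.yd.braidedMul (LinearMap.mul' k R.carrier) (R.rightDiff a ⊗ₜ v) := by
  rw [rightDiff, LinearMap.comp_apply, R.comul_mul, hprim, TensorProduct.tmul_add, map_add,
    map_add, map_add, map_mul_midBraiding_tmul_one, map_mul_midBraiding_one_tmul,
    lTensor_pr_braidedMul, ← LinearMap.comp_apply (LinearMap.lTensor _ _) (LinearMap.lTensor _ _),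
    ← LinearMap.lTensor_comp, pr_one_mul hv, LinearMap.lTensor_comp, LinearMap.comp_apply,
    lTensor_pr_zero_comul h0, add_comm]
  simp

theorem rightDiff_one : R.rightDiff 1 = 0 := by
  simp [rightDiff, R.comul_one, pr_of_mem 1 R.one_mem]

end GradedBraidedHopfAlgebra

/-! ### Uniqueness of Nichols algebras -/

namespace GradedBraidedHopfAlgebra

variable {k : Type*} [Field k] {H : Type*} [Ring H] [HopfAlgebra k H]
  {R : GradedBraidedHopfAlgebra.{_, _, w} k H} {R' : GradedBraidedHopfAlgebra.{_, _, w'} k H}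
  {V : Type*} [AddCommGroup V] [Module k V] {Y : YetterDrinfeld k H V}

/-! ### The graph of the identification of generators -/

section Graph

variable (f : V →ₗ[k] R.carrier) (f' : V →ₗ[k] R'.carrier)

/-- The graph of the correspondence `f v ↔ f' v` between the generators of `R` and `R'`. -/
def genGraph : Submodule k (R.carrier × R'.carrier) :=
  (f.prod f').range

/-- Right multiplication of `R × R'` by the generators. -/
def mulGen : (R.carrier × R'.carrier) ⊗[k] V →ₗ[k] R.carrier × R'.carrier :=
  LinearMap.mul' k _ ∘ₗ (f.prod f').lTensor _

/-- The tensors in `L ^ (n - 1) ⊗ V`, where `L` is the graph of generators, and `0` for `n = 0`. -/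
def graphTensors : ℕ → Submodule k ((R.carrier × R'.carrier) ⊗[k] V)
  | 0 => ⊥
  | n + 1 => LinearMap.range ((genGraph f f' ^ n).subtype.rTensor V)

variable {f f'}

theorem braidedMul_mem_graphTensors {n : ℕ} {t : (R.carrier × R'.carrier) ⊗[k] V}
    (ht : t ∈ graphTensors f f' n) (v : V) :
    Y.braidedMul (mulGen f f') (t ⊗ₜ v) ∈ graphTensors f f' (n + 1) := by
  cases n with
  | zero =>
    obtain rfl : t = 0 := ht
    simp
  | succ n =>
    refine Y.braidedMul_mem (fun x hx v => ?_) ht v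
    rw [pow_succ]
    exact Submodule.mul_mem_mul hx ⟨v, rfl⟩

/-- The product rule has the same shape in both algebras, and its braiding takes place in $V\otimes
V$. Hence a single tensor computes $D$ in both coordinates. -/
theorem exists_graphTensors (hR : R.IsNicholsAlgebra Y) (hR' : R'.IsNicholsAlgebra Y)
    (hf : Y.IsHom R.yd f) (hf' : Y.IsHom R'.yd f') (hf1 : LinearMap.range f = R.comp 1)
    (hf1' : LinearMap.range f' = R'.comp 1) {n : ℕ} {x : R.carrier × R'.carrier}
    (hx : x ∈ genGraph f f' ^ n) :
    ∃ t ∈ graphTensors f f' n,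
      R.rightDiff x.1 = TensorProduct.map (LinearMap.fst k _ _) f t ∧
      R'.rightDiff x.2 = TensorProduct.map (LinearMap.snd k _ _) f' t := by
  induction n generalizing x with
  | zero =>
    rw [pow_zero, Submodule.mem_one] at hx
    obtain ⟨c, rfl⟩ := hx
    refine ⟨0, zero_mem _, ?_, ?_⟩ <;> simp [Algebra.algebraMap_eq_smul_one, rightDiff_one]
  | succ n ih =>
    rw [pow_succ] at hx
    induction hx using Submodule.mul_induction_on' with
    | add x _ y _ hx hy =>
      obtain ⟨s, hs, hs1, hs2⟩ := hx
      obtain ⟨t, ht, ht1, ht2⟩ := hy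
      exact ⟨s + t, add_mem hs ht, by simp [hs1, ht1], by simp [hs2, ht2]⟩
    | mem_mul_mem z hz l hl =>
      obtain ⟨v, rfl⟩ := hl
      obtain ⟨t, ht, ht1, ht2⟩ := ih hz
      have hv : f v ∈ R.comp 1 := hf1 ▸ ⟨v, rfl⟩
      have hv' : f' v ∈ R'.comp 1 := hf1' ▸ ⟨v, rfl⟩
      refine ⟨z ⊗ₜ v + Y.braidedMul (mulGen f f') (t ⊗ₜ v),
        add_mem ⟨⟨z, hz⟩ ⊗ₜ v, rfl⟩ (braidedMul_mem_graphTensors ht v), ?_, ?_⟩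
      · change R.rightDiff (z.1 * f v) = _
        rw [rightDiff_mul hR.comp_zero _ hv ((hR.primitive _).2 hv), map_add, ht1,
          YetterDrinfeld.braidedMul_map hf (μ := mulGen f f') (fun x v => by simp [mulGen])]
        simp
      · change R'.rightDiff (z.2 * f' v) = _
        rw [rightDiff_mul hR'.comp_zero _ hv' ((hR'.primitive _).2 hv'), map_add, ht2,
          YetterDrinfeld.braidedMul_map hf' (μ := mulGen f f') (fun x v => by simp [mulGen])]
        simp

theorem mem_comp_of_mem_genGraph_pow (hf1 : LinearMap.range f = R.comp 1)
    (hf1' : LinearMap.range f' = R'.comp 1) {n : ℕ} {x : R.carrier × R'.carrier}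
    (hx : x ∈ genGraph f f' ^ n) : x.1 ∈ R.comp n ∧ x.2 ∈ R'.comp n := by
  induction n generalizing x with
  | zero =>
    rw [pow_zero, Submodule.mem_one] at hx
    obtain ⟨c, rfl⟩ := hx
    simp only [Algebra.algebraMap_eq_smul_one]
    exact ⟨Submodule.smul_mem _ _ R.one_mem, Submodule.smul_mem _ _ R'.one_mem⟩
  | succ n ih =>
    rw [pow_succ] at hx
    induction hx using Submodule.mul_induction_on' with
    | add x _ y _ hx hy => exact ⟨add_mem hx.1 hy.1, add_mem hx.2 hy.2⟩
    | mem_mul_mem z hz l hl =>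
      obtain ⟨v, rfl⟩ := hl
      exact ⟨R.mul_mem (ih hz).1 (hf1 ▸ ⟨v, rfl⟩), R'.mul_mem (ih hz).2 (hf1' ▸ ⟨v, rfl⟩)⟩

/-- The relations of `R` in degree `n` hold in `R'`. By induction the first projection is injective
on the previous power $L^{n-1}$, so over a field $L^{n-1}\otimes V\to R\otimes R$ is injective. If
the first coordinate vanishes, so does the common tensor, hence $D$ of the second coordinate, hence
that coordinate. -/
theorem snd_eq_zero_of_mem_genGraph_pow (hR : R.IsNicholsAlgebra Y) (hR' : R'.IsNicholsAlgebra Y)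
    (hf : Y.IsHom R.yd f) (hf' : Y.IsHom R'.yd f') (hinj : Function.Injective f)
    (hf1 : LinearMap.range f = R.comp 1) (hf1' : LinearMap.range f' = R'.comp 1)
    {n : ℕ} {x : R.carrier × R'.carrier} (hx : x ∈ genGraph f f' ^ n) (hx1 : x.1 = 0) :
    x.2 = 0 := by
  induction n generalizing x with
  | zero =>
    rw [pow_zero, Submodule.mem_one] at hx
    obtain ⟨c, rfl⟩ := hx
    have h : c • (1 : R.carrier) = 0 := by
      rw [← Algebra.algebraMap_eq_smul_one]
      exact hx1
    -- The counit shows that the scalar itself is zero.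
    have h' := congrArg (Coalgebra.counit (R := k)) h
    rw [map_smul, R.counit_one, map_zero, smul_eq_mul, mul_one] at h'
    simp [h']
  | succ n ih =>
    obtain ⟨_, ⟨t, rfl⟩, ht1, ht2⟩ := exists_graphTensors hR hR' hf hf' hf1 hf1' hx
    have hinj' : Function.Injective
        (LinearMap.fst k R.carrier R'.carrier ∘ₗ (genGraph f f' ^ n).subtype) := by
      rw [injective_iff_map_eq_zero]
      intro a ha
      exact Subtype.ext (Prod.ext ha (ih a.2 ha))
    rw [hx1, map_zero, ← LinearMap.comp_apply, LinearMap.map_comp_rTensor] at ht1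
    obtain rfl : t = 0 := (injective_iff_map_eq_zero _).1
      (TensorProduct.map_injective_of_flat_flat _ _ hinj' hinj) _ ht1.symm
    refine eq_zero_of_rightDiff hR'.comp_zero (fun a => (hR'.primitive a).1) n.succ_ne_zero
      (mem_comp_of_mem_genGraph_pow hf1 hf1' hx).2 ?_
    rw [ht2, map_zero, map_zero]

/-- The algebra generated by `L` is spanned by words in `L`, and a word of length `m` is
bihomogeneous of degree `m`. This reduces injectivity on the whole algebra to the single powers. -/
theorem pr_mem_genGraph_pow (hf1 : LinearMap.range f = R.comp 1)
    (hf1' : LinearMap.range f' = R'.comp 1) {x : R.carrier × R'.carrier}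
    (hx : x ∈ Algebra.adjoin k (genGraph f f' : Set (R.carrier × R'.carrier))) (n : ℕ) :
    (R.pr n x.1, R'.pr n x.2) ∈ genGraph f f' ^ n := by
  have hle : Subalgebra.toSubmodule
      (Algebra.adjoin k (genGraph f f' : Set (R.carrier × R'.carrier))) ≤
      (genGraph f f' ^ n).comap ((R.pr n).prodMap (R'.pr n)) := by
    rw [Algebra.adjoin_eq_span, Submodule.span_le]
    intro y hy
    obtain ⟨m, hm⟩ : ∃ m, y ∈ genGraph f f' ^ m := by
      induction hy using Submonoid.closure_induction with
      | mem y hy => exact ⟨1, by rwa [pow_one]⟩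
      | one => exact ⟨0, by rw [pow_zero]; exact Submodule.one_le.1 le_rfl⟩
      | mul x y _ _ hx hy =>
        obtain ⟨m, hm⟩ := hx
        obtain ⟨m', hm'⟩ := hy
        exact ⟨m + m', by rw [pow_add]; exact Submodule.mul_mem_mul hm hm'⟩
    have h := mem_comp_of_mem_genGraph_pow hf1 hf1' hm
    rw [SetLike.mem_coe, Submodule.mem_comap, LinearMap.prodMap_apply, pr_of_mem _ h.1,
      pr_of_mem _ h.2]
    split_ifs with hmn
    · exact hmn ▸ hm
    · exact zero_mem _
  exact hle hx

end Graph

/-- The identification of the generators of two Nichols algebras of `V` extends to a graded algebra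
homomorphism. -/
theorem IsNicholsAlgebra.exists_algHom (hR : R.IsNicholsAlgebra Y) (hR' : R'.IsNicholsAlgebra Y)
    {f : V →ₗ[k] R.carrier} {f' : V →ₗ[k] R'.carrier}
    (hf : Y.IsHom R.yd f) (hf' : Y.IsHom R'.yd f') (hinj : Function.Injective f)
    (hf1 : LinearMap.range f = R.comp 1) (hf1' : LinearMap.range f' = R'.comp 1) :
    ∃ φ : R.carrier →ₐ[k] R'.carrier, (∀ v, φ (f v) = f' v) ∧
      ∀ n a, φ (R.pr n a) = R'.pr n (φ a) := by
  let Γ := Algebra.adjoin k (genGraph f f' : Set (R.carrier × R'.carrier))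
  let p := (AlgHom.fst k R.carrier R'.carrier).comp Γ.val
  let p' := (AlgHom.snd k R.carrier R'.carrier).comp Γ.val
  have hΓ : ∀ n, genGraph f f' ^ n ≤ Subalgebra.toSubmodule Γ := by
    intro n
    induction n with
    | zero => exact Submodule.one_le.2 Γ.one_mem
    | succ n ih =>
      rw [pow_succ, Submodule.mul_le]
      exact fun x hx y hy => Γ.mul_mem (ih hx) (Algebra.subset_adjoin hy)
  -- Bijectivity of the first projection says that `Γ` is the graph of a map; that map is the second
  -- projection after the inverse of the first.
  have hbij : Function.Bijective p := by
    constructor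
    · rw [injective_iff_map_eq_zero]
      intro x hx
      have hx1 : x.1.1 = 0 := hx
      refine Subtype.ext (Prod.ext hx1 (eq_zero_of_pr fun n => ?_))
      exact snd_eq_zero_of_mem_genGraph_pow hR hR' hf hf' hinj hf1 hf1'
        (pr_mem_genGraph_pow hf1 hf1' x.2 n) (by rw [hx1, map_zero])
    · rw [← AlgHom.range_eq_top, eq_top_iff, ← hR.generated, Algebra.adjoin_le_iff, ← hf1]
      rintro _ ⟨v, rfl⟩
      exact ⟨⟨(f v, f' v), Algebra.subset_adjoin ⟨v, rfl⟩⟩, rfl⟩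
  let e := AlgEquiv.ofBijective p hbij
  have he : ∀ x : Γ, (p'.comp e.symm.toAlgHom) x.1.1 = x.1.2 := by
    intro x
    have : e.symm x.1.1 = x := e.symm_apply_eq.2 rfl
    change p' (e.symm x.1.1) = _
    rw [this]
    rfl
  refine ⟨p'.comp e.symm.toAlgHom, fun v => he ⟨(f v, f' v), Algebra.subset_adjoin ⟨v, rfl⟩⟩,
    fun n a => ?_⟩
  obtain ⟨x, rfl⟩ := e.surjective a
  change (p'.comp e.symm.toAlgHom) (R.pr n x.1.1) = R'.pr n ((p'.comp e.symm.toAlgHom) x.1.1)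
  rw [he, he ⟨_, hΓ n (pr_mem_genGraph_pow hf1 hf1' x.2 n)⟩]

/-- An algebra homomorphism out of an algebra generated by `R(1)` is `H`-linear if it is so on
`R(1)`. -/
theorem map_act_of_comp_one (hgen : Algebra.adjoin k (R.comp 1 : Set R.carrier) = ⊤)
    {φ : R.carrier →ₐ[k] R'.carrier}
    (h : ∀ g, ∀ a ∈ R.comp 1, φ (R.yd.act g a) = R'.yd.act g (φ a)) (g : H) (a : R.carrier) :
    φ (R.yd.act g a) = R'.yd.act g (φ a) := by
  have ha : a ∈ Algebra.adjoin k (R.comp 1 : Set R.carrier) := hgen ▸ Algebra.mem_top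
  induction ha using Algebra.adjoin_induction generalizing g with
  | mem a ha => exact h g a ha
  | algebraMap r =>
    simp [Algebra.algebraMap_eq_smul_one, R.act_one, R'.act_one]
  | add a b _ _ ha hb => simp only [map_add, ha, hb]
  | mul a b _ _ ha hb =>
    have h1 := R.act_mul g (a ⊗ₜ b)
    have h2 := R'.act_mul g (φ a ⊗ₜ φ b)
    rw [LinearMap.mul'_apply] at h1 h2
    rw [h1, map_mul, h2]
    simp only [YetterDrinfeld.tensorAct, LinearMap.comp_apply]
    generalize Coalgebra.comul (R := k) g = t
    induction t with
    | zero => simp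
    | add x y hx hy => simp only [map_add, LinearMap.add_apply, hx, hy]
    | tmul x y => simp [ha, hb]

/-- An algebra homomorphism out of an algebra generated by `R(1)` is `H`-colinear if it is so on
`R(1)`. -/
theorem map_coact_of_comp_one (hgen : Algebra.adjoin k (R.comp 1 : Set R.carrier) = ⊤)
    {φ : R.carrier →ₐ[k] R'.carrier}
    (h : ∀ a ∈ R.comp 1, R'.yd.coact (φ a) = φ.toLinearMap.lTensor H (R.yd.coact a))
    (a : R.carrier) : R'.yd.coact (φ a) = φ.toLinearMap.lTensor H (R.yd.coact a) := by
  have ha : a ∈ Algebra.adjoin k (R.comp 1 : Set R.carrier) := hgen ▸ Algebra.mem_top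
  induction ha using Algebra.adjoin_induction with
  | mem a ha => exact h a ha
  | algebraMap r =>
    simp [Algebra.algebraMap_eq_smul_one, R.coact_one, R'.coact_one]
  | add a b _ _ ha hb => simp only [map_add, ha, hb]
  | mul a b _ _ ha hb =>
    have h1 := R.coact_mul (a ⊗ₜ b)
    have h2 := R'.coact_mul (φ a ⊗ₜ φ b)
    rw [LinearMap.mul'_apply] at h1 h2
    rw [h1, map_mul, h2]
    simp only [YetterDrinfeld.tensorCoact, LinearMap.comp_apply, TensorProduct.map_tmul, ha, hb]
    generalize R.yd.coact a = s
    generalize R.yd.coact b = t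
    induction s with
    | zero => simp
    | add x y hx hy => simp only [map_add, TensorProduct.add_tmul, hx, hy]
    | tmul x y =>
      induction t with
      | zero => simp
      | add x y hx hy => simp only [map_add, TensorProduct.tmul_add, hx, hy]
      | tmul x y => simp

/-- Both counits are multiplicative and vanish in degree one. -/
theorem counit_map_of_comp_one (hgen : Algebra.adjoin k (R.comp 1 : Set R.carrier) = ⊤)
    {φ : R.carrier →ₐ[k] R'.carrier} (h : ∀ a ∈ R.comp 1, φ a ∈ R'.comp 1) (a : R.carrier) :
    Coalgebra.counit (R := k) (φ a) = Coalgebra.counit (R := k) a := by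
  have ha : a ∈ Algebra.adjoin k (R.comp 1 : Set R.carrier) := hgen ▸ Algebra.mem_top
  induction ha using Algebra.adjoin_induction with
  | mem a ha => rw [R.counit_of_mem one_ne_zero ha, R'.counit_of_mem one_ne_zero (h a ha)]
  | algebraMap r =>
    simp [Algebra.algebraMap_eq_smul_one, R.counit_one, R'.counit_one]
  | add a b _ _ ha hb => simp only [map_add, ha, hb]
  | mul a b _ _ ha hb => rw [map_mul, R.counit_mul, R'.counit_mul, ha, hb]

/-- An algebra homomorphism of Yetter–Drinfeld modules out of an algebra generated by `R(1)` is a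
coalgebra map if it is so on `R(1)`. -/
theorem comul_map_of_comp_one (hgen : Algebra.adjoin k (R.comp 1 : Set R.carrier) = ⊤)
    {φ : R.carrier →ₐ[k] R'.carrier} (hφ : R.yd.IsHom R'.yd φ.toLinearMap)
    (h : ∀ a ∈ R.comp 1, Coalgebra.comul (R := k) (φ a) =
      TensorProduct.map φ.toLinearMap φ.toLinearMap (Coalgebra.comul (R := k) a))
    (a : R.carrier) : Coalgebra.comul (R := k) (φ a) =
      TensorProduct.map φ.toLinearMap φ.toLinearMap (Coalgebra.comul (R := k) a) := by
  have ha : a ∈ Algebra.adjoin k (R.comp 1 : Set R.carrier) := hgen ▸ Algebra.mem_top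
  induction ha using Algebra.adjoin_induction with
  | mem a ha => exact h a ha
  | algebraMap r =>
    simp [Algebra.algebraMap_eq_smul_one, R.comul_one, R'.comul_one]
  | add a b _ _ ha hb => simp only [map_add, ha, hb]
  | mul a b _ _ ha hb =>
    rw [map_mul, R.comul_mul, R'.comul_mul, ha, hb, YetterDrinfeld.midBraiding_map hφ]
    generalize R.yd.midBraiding _ = t
    simp only [← LinearMap.comp_apply, ← TensorProduct.map_comp]
    have hmul : LinearMap.mul' k R'.carrier ∘ₗ TensorProduct.map φ.toLinearMap φ.toLinearMap =
        φ.toLinearMap ∘ₗ LinearMap.mul' k R.carrier := by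
      ext x y
      simp
    rw [hmul]

/-- Any two Nichols algebras of a Yetter–Drinfeld module are isomorphic. -/
theorem IsNicholsAlgebra.isomorphic (hR : R.IsNicholsAlgebra Y) (hR' : R'.IsNicholsAlgebra Y) :
    R.Isomorphic R' := by
  obtain ⟨f, hf, hinj, hf1⟩ := hR.comp_one
  obtain ⟨f', hf', hinj', hf1'⟩ := hR'.comp_one
  obtain ⟨φ, hφ, hφpr⟩ := hR.exists_algHom hR' hf hf' hinj hf1 hf1'
  obtain ⟨ψ, hψ, -⟩ := hR'.exists_algHom hR hf' hf hinj' hf1' hf1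
  have hφψ : φ.comp ψ = AlgHom.id k R'.carrier := by
    refine AlgHom.ext_of_adjoin_eq_top hR'.generated ?_
    rw [← hf1']
    rintro _ ⟨v, rfl⟩
    simp [hφ, hψ]
  have hψφ : ψ.comp φ = AlgHom.id k R.carrier := by
    refine AlgHom.ext_of_adjoin_eq_top hR.generated ?_
    rw [← hf1]
    rintro _ ⟨v, rfl⟩
    simp [hφ, hψ]
  have hYD : R.yd.IsHom R'.yd φ.toLinearMap := by
    refine ⟨map_act_of_comp_one hR.generated ?_, map_coact_of_comp_one hR.generated ?_⟩
    · rw [← hf1]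
      rintro g _ ⟨v, rfl⟩
      rw [← hf.1, hφ, hφ, hf'.1]
    · rw [← hf1]
      rintro _ ⟨v, rfl⟩
      have : φ.toLinearMap ∘ₗ f = f' := LinearMap.ext hφ
      rw [hf.2, hφ, hf'.2, ← this, LinearMap.lTensor_comp, LinearMap.comp_apply]
  have hφ1 : ∀ a ∈ R.comp 1, φ a ∈ R'.comp 1 := by
    rw [← hf1, ← hf1']
    rintro _ ⟨v, rfl⟩
    exact ⟨v, (hφ v).symm⟩
  refine ⟨AlgEquiv.ofAlgHom φ ψ hφψ hψφ, hYD, counit_map_of_comp_one hR.generated hφ1,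
    comul_map_of_comp_one hR.generated hYD fun a ha => ?_, fun n => ?_⟩
  -- Generators are primitive on both sides, so the comultiplications agree on them.
  · rw [(hR.primitive a).2 ha, (hR'.primitive _).2 (hφ1 a ha)]
    simp
  · apply le_antisymm
    · rintro _ ⟨a, ha, rfl⟩
      have h := hφpr n a
      rw [pr_self ha] at h
      change φ a ∈ _
      rw [h]
      exact pr_mem n _
    · intro b hb
      -- Projecting `ψ b` to degree `n` makes the gradedness of `ψ` unnecessary: `φ` commutes with
      -- the projections.
      refine ⟨R.pr n (ψ b), pr_mem n _, ?_⟩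
      change φ (R.pr n (ψ b)) = b
      rw [hφpr, ← AlgHom.comp_apply, hφψ, AlgHom.id_apply, pr_self hb]

/-- Being a Nichols algebra of `V` depends only on the isomorphism class of `V`. -/
theorem IsNicholsAlgebra.congr {W : Type*} [AddCommGroup W] [Module k W]
    {Z : YetterDrinfeld k H W} (hR : R.IsNicholsAlgebra Y) (hYZ : Y.Isomorphic Z) :
    R.IsNicholsAlgebra Z := by
  obtain ⟨f, hf, hinj, hf1⟩ := hR.comp_one
  obtain ⟨e, he⟩ := hYZ
  have he' := he.symm
  refine ⟨hR.comp_zero, ⟨f ∘ₗ e.symm.toLinearMap, ⟨fun h v => ?_, fun v => ?_⟩, ?_, ?_⟩,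
    hR.primitive, hR.generated⟩
  · rw [LinearMap.comp_apply, he'.1, hf.1, LinearMap.comp_apply]
  · rw [LinearMap.comp_apply, hf.2, he'.2, LinearMap.lTensor_comp, LinearMap.comp_apply]
  · exact hinj.comp e.symm.injective
  · rw [LinearMap.range_comp, LinearEquiv.range, Submodule.map_top, hf1]

end GradedBraidedHopfAlgebra

end

/-! ### The ramification system and the Nichols algebras of its arrow module -/

theorem proposition2p4 {k : Type u₁} [Field k] {G : Type u₂} [Group G] [Finite G]
    (hchar : ¬ ringChar k ∣ Nat.card G) :
    (∀ (N : Type v) [AddCommGroup N] [Module k N] (Y : YetterDrinfeld k (MonoidAlgebra k G) N),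
      ∃ S : RSR.{u₁, u₂, v} k G, ∀ c : S.Choices, Y.Isomorphic c.ydFromOne) ∧
    (∀ (N : Type v) [AddCommGroup N] [Module k N] (Y : YetterDrinfeld k (MonoidAlgebra k G) N)
      (B : GradedBraidedHopfAlgebra.{u₁, max u₁ u₂, w} k (MonoidAlgebra k G)),
      B.IsNicholsAlgebra Y →
      ∃ S : RSR.{u₁, u₂, v} k G, ∀ c : S.Choices,
        (∃ B' : GradedBraidedHopfAlgebra.{u₁, max u₁ u₂, w} k (MonoidAlgebra k G),
          B'.IsNicholsAlgebra c.ydFromOne ∧ B.Isomorphic B') ∧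
        ∀ B' : GradedBraidedHopfAlgebra.{u₁, max u₁ u₂, w'} k (MonoidAlgebra k G),
          B'.IsNicholsAlgebra c.ydFromOne → B.Isomorphic B') := by
  refine ⟨fun N _ _ Y => Y.exists_rsr_isomorphic hchar, fun N _ _ Y B hB => ?_⟩
  obtain ⟨S, hS⟩ := Y.exists_rsr_isomorphic hchar
  -- `B` itself serves as a Nichols algebra of the arrow module, by transport along the isomorphism
  -- of (i).
  refine ⟨S, fun c => ⟨⟨B, hB.congr (hS c), hB.isomorphic hB⟩, fun B' hB' => ?_⟩⟩
  exact (hB.congr (hS c)).isomorphic hB'
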